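/- Let $X$ and $D$ be complex Banach spaces with $D$ densely and continuously embedded in $X$, let $T>0$ and $J=(0,T)$. For $r\in(1,\infty)$ let $W^{1,r}_0(J;X)$ be the space of all $u\in L^r(J;X)$ whose $X$-valued distributional derivative $u'$ belongs to $L^r(J;X)$ and whose continuous representative satisfies $u(0)=0$. Consider families $\{A(t)\}_{t\in J}$ in $\mathcal L(D;X)$ which are bounded, i.e. $\sup_{t\in J}\|A(t)\|_{D\to X}<\infty$, (strongly) measurable, i.e. $t\mapsto A(t)\psi\in X$ is Bochner measurable on $J$ for every $\psi\in D$, and such that for every $t\in J$ the operator $A(t)$, viewed as an operator in $X$ with domain $D$, is closed. Such a family is said to satisfy maximal parabolic $L^r(J;X)$-regularity if for every $f\in L^r(J;X)$ there is a unique $u\in L^r(J;D)\cap W^{1,r}_0(J;X)$ with $$u'(t)+A(t)u(t)=f(t)\quad\text{for almost all }t\in J.$$ A single operator $K\in\mathcal L(D;X)$ is said to satisfy maximal parabolic regularity on $X$ if the constant family $A(t)=K$ satisfies maximal parabolic $L^p(J;X)$-regularity for some $p\in(1,\infty)$. **Corollary 3.5.** Let $\{B(t)\}_{t\in J}$ be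 a bounded and measurable family in $\mathcal L(D;X)$ such that $B(t)$ is closed in $X$ for every $t\in J$. Suppose that there is an operator $K\in\mathcal L(D;X)$ which satisfies maximal parabolic regularity on $X$. Let $r\in(1,\infty)$ and suppose that $\{B(t)\}_{t\in J}$ satisfies maximal parabolic $L^r(J;X)$-regularity. Then there exists an open interval $I\subset(1,\infty)$ with $r\in I$ such that $\{B(t)\}_{t\in J}$ satisfies maximal parabolic $L^s(J;X)$-regularity for all $s\in I$. -/

import Mathlib

open MeasureTheory Set
open scoped ContDiff

namespace ParabolicReg

/-- Lebesgue measure on the time interval `J = (0, T)`. Functions on `J` are represented by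
functions on `ℝ` whose values outside `J` play no role. -/
noncomputable def timeMeasure (T : ℝ) : Measure ℝ :=
  volume.restrict (Ioo 0 T)

/-- `f ∈ L^r(J; X)`: Bochner measurable with `∫_J ‖f‖^r < ∞`. -/
def MemLr {X : Type*} [NormedAddCommGroup X] (T r : ℝ) (f : ℝ → X) : Prop :=
  MemLp f (ENNReal.ofReal r) (timeMeasure T)

/-- `u'` is the derivative of `u` on `J = (0, T)` in the sense of `X`-valued distributions,
both being locally integrable: `∫_J φ' u = - ∫_J φ u'` for every test function
`φ ∈ C_c^∞(J)`. -/
structure HasWeakDeriv {X : Type*} [NormedAddCommGroup X] [NormedSpace ℝ X]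
    (T : ℝ) (u u' : ℝ → X) : Prop where
  locallyIntegrable : LocallyIntegrableOn u (Ioo 0 T)
  locallyIntegrable_deriv : LocallyIntegrableOn u' (Ioo 0 T)
  integral_eq : ∀ φ : ℝ → ℝ, ContDiff ℝ ∞ φ → HasCompactSupport φ → tsupport φ ⊆ Ioo 0 T →
    ∫ t in Ioo 0 T, deriv φ t • u t = - ∫ t in Ioo 0 T, φ t • u' t

/-- `u ∈ W^{1,r}(J; X)`. -/
def MemW1 {X : Type*} [NormedAddCommGroup X] [NormedSpace ℝ X] (T r : ℝ) (u : ℝ → X) : Prop :=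
  MemLr T r u ∧ ∃ u' : ℝ → X, MemLr T r u' ∧ HasWeakDeriv T u u'

/-- `u(0) = 0` for the representative of `u` that is continuous on `[0, T]`. -/
def VanishesAtZero {X : Type*} [NormedAddCommGroup X] (T : ℝ) (u : ℝ → X) : Prop :=
  ∃ v : ℝ → X, ContinuousOn v (Icc 0 T) ∧ u =ᵐ[timeMeasure T] v ∧ v 0 = 0

/-- `u ∈ W_0^{1,r}(J; X) = {ψ ∈ W^{1,r}(J; X) : ψ(0) = 0}`. -/
def MemW10 {X : Type*} [NormedAddCommGroup X] [NormedSpace ℝ X] (T r : ℝ) (u : ℝ → X) : Prop :=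
  MemW1 T r u ∧ VanishesAtZero T u

section

variable {D X : Type*} [NormedAddCommGroup D] [NormedSpace ℂ D]
  [NormedAddCommGroup X] [NormedSpace ℂ X]

/-- `u ∈ MR_0^r(J; D, X) = L^r(J; D) ∩ W_0^{1,r}(J; X)`, where `ι` is the embedding of `D`
into `X`. -/
def MemMR (ι : D →L[ℂ] X) (T r : ℝ) (u : ℝ → D) : Prop :=
  MemLr T r u ∧ MemW10 T r (fun t => ι (u t))

/-- `u'(t) + A(t) u(t) = f(t)` for almost all `t ∈ J`, where `u'` is the distributional
derivative of `u` as a function with values in `X`. -/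
def SolvesAE (ι : D →L[ℂ] X) (T : ℝ) (A : ℝ → D →L[ℂ] X) (u : ℝ → D) (f : ℝ → X) : Prop :=
  ∃ u' : ℝ → X, HasWeakDeriv T (fun t => ι (u t)) u' ∧
    ∀ᵐ t ∂(timeMeasure T), u' t + A t (u t) = f t

/-- The operator `A`, regarded as an operator in `X` with domain `D`, is closed: its graph is
closed in `X × X`. -/
def IsClosedIn (ι A : D →L[ℂ] X) : Prop :=
  IsClosed (range fun d : D => (ι d, A d))

/-- The family `{A(t)}`, `t ∈ J`, is bounded in `L(D; X)`, measurable (each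
`t ↦ A(t) ψ`, `ψ ∈ D`, is Bochner measurable), and consists of operators that are closed
in `X`. -/
structure IsAdmissible (ι : D →L[ℂ] X) (T : ℝ) (A : ℝ → D →L[ℂ] X) : Prop where
  bounded : ∃ C : ℝ, ∀ t ∈ Ioo 0 T, ‖A t‖ ≤ C
  measurable : ∀ ψ : D, AEStronglyMeasurable (fun t => A t ψ) (timeMeasure T)
  closed : ∀ t ∈ Ioo 0 T, IsClosedIn ι (A t)

/-- Non-autonomous maximal parabolic `L^r(J; X)`-regularity of `{A(t)}`, `t ∈ J`: the family is
admissible, and for every `f ∈ L^r(J; X)` there is a unique (as an almost everywhere class)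
`u ∈ MR_0^r(J; D, X)` with `u' + A(·) u = f` almost everywhere on `J`. -/
structure HasMaxReg (ι : D →L[ℂ] X) (T r : ℝ) (A : ℝ → D →L[ℂ] X) : Prop where
  admissible : IsAdmissible ι T A
  exists_unique : ∀ f : ℝ → X, MemLr T r f →
    ∃ u : ℝ → D, (MemMR ι T r u ∧ SolvesAE ι T A u f) ∧
      ∀ v : ℝ → D, MemMR ι T r v ∧ SolvesAE ι T A v f → v =ᵐ[timeMeasure T] u

/-- The single operator `K` satisfies maximal parabolic regularity on `X`: the constant family
`K` satisfies maximal parabolic `L^p(J; X)`-regularity for some `p ∈ (1, ∞)`. -/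
def HasAutonomousMaxReg (ι : D →L[ℂ] X) (T : ℝ) (K : D →L[ℂ] X) : Prop :=
  ∃ p : ℝ, 1 < p ∧ HasMaxReg ι T p (fun _ => K)

end

end ParabolicReg

/-! Solutions are treated as pairs `(u, w)` with `ι (u t) = ∫ τ in 0..t, w τ`; put `h = ‖u‖ + ‖w‖`
and `k = ‖w + B u‖`. Maximal regularity at an exponent says that the bounded operator `(u, w) ↦ w +
B(·) u` from the Banach space of such pairs to the Lebesgue space is bijective
(`hasMaxReg_iff_bijective`). At `r` the bounded inverse theorem therefore gives `∫ h ^ r ≤ A ∫ k ^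
r` (`exists_aprioriEstimate`). It remains to carry this estimate to nearby exponents, although `B`
is only measurable in time.

The tool is a truncation at height `l` (`exists_truncation`). Let `O` be the set where the maximal
function of `h` exceeds `l`. Off `O` the pair is kept. On `O` the function `u` is averaged over a
backward interval of length half the distance to the complement of `O`, and `w` is replaced by the
derivative of the averaged primitive, so the result `(v, z)` is again an admissible pair. On `O` it
is bounded by a multiple of `l`, and `O` has measure at most `(10 / l) ∫_{h > l/2} h`.

For `s > r` the estimate is applied to `(u - v, w - z)`, which lives on `O`, and controls `∫_{h > l}
h ^ r`. For `s < r` it is applied to `(v, z)`, which is bounded and hence admissible at the exponent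
`r`, and controls `∫_{h ≤ l} h ^ r`. Both inequalities have the error term `l ^ (r - 1) ∫_{h > l/2}
h`. Multiplication by `l ^ (s - r - 1)` and integration in `l` turn this error into a multiple of
`|s - r| ∫ h ^ s`, which is absorbed when `s` is close to `r` (`lintegral_rpow_le_of_level_gt`,
`lintegral_rpow_le_of_level_le`).

Above `r` this raises the integrability of the solution already known at `r`. Below `r` it bounds
the operator from below, and surjectivity follows because the range contains all simple functions.
-/

namespace ParabolicReg

/-! ### Weak derivatives on an interval and primitives -/

section WeakDerivative

variable {X : Type*} [NormedAddCommGroup X] [NormedSpace ℝ X]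

/-- Fubini on the triangle `0 < τ < t < T`: the integral of `deriv φ` over `(τ, T)` is `-φ τ`, since
`φ T = 0`. -/
theorem integral_deriv_smul_primitive [CompleteSpace X] {T : ℝ} {w : ℝ → X}
    (hw : IntegrableOn w (Ioo 0 T)) {φ : ℝ → ℝ} (hφ : ContDiff ℝ ∞ φ)
    (hφc : HasCompactSupport φ) (hφs : tsupport φ ⊆ Ioo 0 T) :
    ∫ t in Ioo 0 T, deriv φ t • ∫ τ in 0..t, w τ = - ∫ t in Ioo 0 T, φ t • w t := by
  have hφ1 : Continuous (deriv φ) := hφ.continuous_deriv (by simp)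
  have hφT : φ T = 0 := image_eq_zero_of_notMem_tsupport fun h => lt_irrefl _ (hφs h).2
  have h1 : ∀ t ∈ Ioo 0 T, deriv φ t • ∫ τ in 0..t, w τ =
      ∫ τ in Ioo 0 T, (Ioi τ).indicator (deriv φ) t • w τ := by
    intro t ht
    rw [intervalIntegral.integral_of_le ht.1.le, ← integral_smul,
      integral_Ioc_eq_integral_Ioo, ← integral_indicator measurableSet_Ioo,
      ← integral_indicator measurableSet_Ioo]
    congr 1
    ext τ
    by_cases h1 : τ ∈ Ioo 0 t
    · rw [indicator_of_mem h1, indicator_of_mem (show τ ∈ Ioo 0 T from ⟨h1.1, h1.2.trans ht.2⟩),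
        indicator_of_mem (show t ∈ Ioi τ from h1.2)]
    · rw [indicator_of_notMem h1]
      by_cases h2 : τ ∈ Ioo 0 T
      · rw [indicator_of_mem h2, indicator_of_notMem, zero_smul]
        exact fun h3 => h1 ⟨h2.1, h3⟩
      · rw [indicator_of_notMem h2]
  rw [setIntegral_congr_fun measurableSet_Ioo h1, integral_integral_swap]
  · rw [← integral_neg]
    refine setIntegral_congr_fun measurableSet_Ioo fun τ hτ => ?_
    rw [integral_smul_const, ← neg_smul]
    congr 1
    rw [setIntegral_indicator measurableSet_Ioi]
    have : Ioo 0 T ∩ Ioi τ = Ioo τ T := by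
      ext x; simp only [mem_inter_iff, mem_Ioo, mem_Ioi] at hτ ⊢
      constructor
      · rintro ⟨h1, h2⟩; exact ⟨h2, h1.2⟩
      · rintro ⟨h1, h2⟩; exact ⟨⟨hτ.1.trans h1, h2⟩, h1⟩
    rw [this, ← integral_Ioc_eq_integral_Ioo, ← intervalIntegral.integral_of_le hτ.2.le,
      intervalIntegral.integral_deriv_eq_sub (fun x _ => (hφ.differentiable (by simp)) x)
        (hφ1.intervalIntegrable _ _), hφT, zero_sub]
  · obtain ⟨C, hC⟩ := (hφc.deriv).exists_bound_of_continuous hφ1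
    have hC0 : 0 ≤ C := (norm_nonneg _).trans (hC 0)
    have hint : Integrable (fun p : ℝ × ℝ => C * ‖w p.2‖)
        ((volume.restrict (Ioo 0 T)).prod (volume.restrict (Ioo 0 T))) :=
      (hw.norm.comp_snd (volume.restrict (Ioo 0 T))).const_mul C
    refine hint.mono' ?_ ?_
    · refine AEStronglyMeasurable.smul (f := fun p : ℝ × ℝ => (Ioi p.2).indicator (deriv φ) p.1)
        (g := fun p : ℝ × ℝ => w p.2) ?_
        hw.aestronglyMeasurable.comp_snd
      have : (fun p : ℝ × ℝ => (Ioi p.2).indicator (deriv φ) p.1) =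
          {p : ℝ × ℝ | p.2 < p.1}.indicator (fun p => deriv φ p.1) := by
        ext p; simp [indicator]
      rw [this]
      exact ((hφ1.measurable.comp measurable_fst).indicator
        (measurableSet_lt measurable_snd measurable_fst)).aestronglyMeasurable
    · refine Filter.Eventually.of_forall fun p => ?_
      simp only [Function.uncurry]
      rw [norm_smul]
      refine mul_le_mul_of_nonneg_right ?_ (norm_nonneg _)
      rw [norm_indicator_eq_indicator_norm]
      exact (indicator_le_self' (fun _ _ => norm_nonneg _) _).trans (hC _)

theorem continuousOn_primitive_Ioo {T : ℝ} (hT : 0 ≤ T) {w : ℝ → X}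
    (hw : IntegrableOn w (Ioo 0 T)) : ContinuousOn (fun t => ∫ τ in 0..t, w τ) (Icc 0 T) := by
  have h := intervalIntegral.continuousOn_primitive_interval (μ := volume) (a := 0) (b := T)
    (f := w) (by rwa [uIcc_of_le hT, integrableOn_Icc_iff_integrableOn_Ioo])
  rwa [uIcc_of_le hT] at h

theorem hasWeakDeriv_of_primitive [CompleteSpace X] {T : ℝ} (hT : 0 ≤ T) {u w : ℝ → X}
    (hw : IntegrableOn w (Ioo 0 T))
    (hu : ∀ᵐ t ∂(timeMeasure T), u t = ∫ τ in 0..t, w τ) :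
    HasWeakDeriv T u w ∧ VanishesAtZero T u := by
  have hc := continuousOn_primitive_Ioo hT hw
  refine ⟨⟨?_, hw.locallyIntegrableOn, ?_⟩, _, hc, hu, by simp⟩
  · refine IntegrableOn.locallyIntegrableOn ?_
    refine Integrable.congr ?_ (Filter.EventuallyEq.symm hu)
    exact (hc.integrableOn_compact isCompact_Icc).mono_set Ioo_subset_Icc_self
  · intro φ hφ hφc hφs
    rw [← integral_deriv_smul_primitive hw hφ hφc hφs]
    refine integral_congr_ae ?_
    filter_upwards [hu] with t ht
    rw [ht]

/-- A test function of integral zero has an antiderivative which is a test function. -/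
theorem exists_antideriv_testFunction {T : ℝ} (hT : 0 < T) {η : ℝ → ℝ} (hη : ContDiff ℝ ∞ η)
    (hηc : HasCompactSupport η) (hηs : tsupport η ⊆ Ioo 0 T) (hη0 : ∫ t, η t = 0) :
    ∃ φ : ℝ → ℝ, ContDiff ℝ ∞ φ ∧ HasCompactSupport φ ∧ tsupport φ ⊆ Ioo 0 T ∧
      deriv φ = η := by
  obtain ⟨a, b, ha, hb, hab⟩ : ∃ a b, 0 < a ∧ b < T ∧ tsupport η ⊆ Icc a b := by
    -- The point `T / 2` is inserted only to make the compact set nonempty, so that it has a least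
    -- and a greatest element.
    have hK : IsCompact (insert (T / 2) (tsupport η)) := IsCompact.insert hηc _
    have hKs : insert (T / 2) (tsupport η) ⊆ Ioo 0 T :=
      insert_subset ⟨by linarith, by linarith⟩ hηs
    obtain ⟨a, ha⟩ := hK.exists_isLeast (insert_nonempty _ _)
    obtain ⟨b, hb⟩ := hK.exists_isGreatest (insert_nonempty _ _)
    exact ⟨a, b, (hKs ha.1).1, (hKs hb.1).2, fun x hx =>
      ⟨ha.2 (mem_insert_of_mem _ hx), hb.2 (mem_insert_of_mem _ hx)⟩⟩
  have hz : ∀ x, x ∉ Icc a b → η x = 0 := fun x hx =>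
    image_eq_zero_of_notMem_tsupport fun h => hx (hab h)
  have hder : ∀ x, HasDerivAt (fun t => ∫ τ in 0..t, η τ) (η x) x := fun x =>
    intervalIntegral.integral_hasDerivAt_right (hη.continuous.intervalIntegrable _ _)
      hη.continuous.aestronglyMeasurable.stronglyMeasurableAtFilter hη.continuous.continuousAt
  have hd : deriv (fun t => ∫ τ in 0..t, η τ) = η := funext fun x => (hder x).deriv
  have hsupp : tsupport (fun t => ∫ τ in 0..t, η τ) ⊆ Icc a b := by
    refine closure_minimal (fun t ht => ?_) isClosed_Icc
    by_contra hn
    refine ht ?_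
    rw [mem_Icc, not_and_or, not_le, not_le] at hn
    rcases hn with hn | hn
    · refine intervalIntegral.integral_zero_ae (Filter.Eventually.of_forall fun x hx => hz x ?_)
      rintro ⟨h1, -⟩
      have := (mem_uIoc.1 hx)
      rcases this with h | h <;> linarith [h.1, h.2]
    · have h1 : ∫ τ in 0..t, η τ = ∫ τ, η τ := by
        refine intervalIntegral.integral_eq_integral_of_support_subset fun x hx => ?_
        by_contra hx2
        refine hx (hz x fun hx3 => hx2 ⟨ha.trans_le hx3.1, hx3.2.trans hn.le⟩)
      simpa [hη0] using h1
  refine ⟨fun t => ∫ τ in 0..t, η τ, ?_, ?_, ?_, hd⟩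
  · rw [contDiff_infty_iff_deriv]
    exact ⟨fun x => (hder x).differentiableAt, by rw [hd]; exact hη⟩
  · exact isCompact_Icc.of_isClosed_subset (isClosed_tsupport _) hsupp
  · exact hsupp.trans fun x hx => ⟨ha.trans_le hx.1, hx.2.trans_lt hb⟩

theorem integrableOn_smul_of_tsupport_subset {T : ℝ} {z : ℝ → X}
    (hz : LocallyIntegrableOn z (Ioo 0 T)) {φ : ℝ → ℝ} (h1 : Continuous φ)
    (h2 : HasCompactSupport φ) (h3 : tsupport φ ⊆ Ioo 0 T) :
    IntegrableOn (fun t => φ t • z t) (Ioo 0 T) := by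
  have hzK : IntegrableOn z (tsupport φ) := hz.integrableOn_compact_subset h3 h2
  obtain ⟨C, hC⟩ := h2.exists_bound_of_continuous h1
  have h4 : IntegrableOn (fun t => φ t • z t) (tsupport φ) :=
    Integrable.bdd_smul hzK C h1.aestronglyMeasurable (Filter.Eventually.of_forall hC)
  rw [integrableOn_iff_integrable_of_support_subset] at h4
  · exact h4.integrableOn
  · exact (Function.support_smul_subset_left _ _).trans (subset_tsupport φ)

/-- **du Bois-Reymond lemma**. -/
theorem exists_ae_eq_const_of_integral_deriv_smul_eq_zero [CompleteSpace X] {T : ℝ} (hT : 0 < T)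
    {z : ℝ → X} (hz : LocallyIntegrableOn z (Ioo 0 T))
    (h : ∀ φ : ℝ → ℝ, ContDiff ℝ ∞ φ → HasCompactSupport φ → tsupport φ ⊆ Ioo 0 T →
      ∫ t in Ioo 0 T, deriv φ t • z t = 0) :
    ∃ c : X, ∀ᵐ t ∂(timeMeasure T), z t = c := by
  let b : ContDiffBump (T / 2) := ⟨T / 8, T / 4, by positivity, by linarith⟩
  set ρ : ℝ → ℝ := b.normed volume with hρ
  have hρs : ContDiff ℝ ∞ ρ := b.contDiff_normed
  have hρc : HasCompactSupport ρ := b.hasCompactSupport_normed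
  have hρT : tsupport ρ ⊆ Ioo 0 T := by
    rw [hρ, b.tsupport_normed_eq, Real.closedBall_eq_Icc]
    intro x hx
    simp only [b, mem_Icc, mem_Ioo] at hx ⊢
    constructor <;> linarith [hx.1, hx.2]
  have hρ1 : ∫ t, ρ t = 1 := b.integral_normed
  have hint := fun φ => integrableOn_smul_of_tsupport_subset (φ := φ) hz
  set c : X := ∫ t in Ioo 0 T, ρ t • z t with hc
  refine ⟨c, ?_⟩
  have key : ∀ᵐ t : ℝ, t ∈ Ioo 0 T → z t - c = 0 := by
    refine isOpen_Ioo.ae_eq_zero_of_integral_contDiff_smul_eq_zero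
      (hz.sub ((integrableOn_const (by simp)).locallyIntegrableOn)) ?_
    intro ψ hψ hψc hψs
    -- Since `ρ` has integral one, `ψ - m ρ` has integral zero and is therefore the derivative of a
    -- test function. Testing with it gives `∫ ψ z = m c = ∫ ψ c`.
    set m : ℝ := ∫ t, ψ t with hm
    have hmρs : tsupport (fun t => m * ρ t) ⊆ tsupport ρ :=
      closure_mono (Function.support_mul_subset_right _ _)
    have hsub : tsupport (fun t => ψ t - m * ρ t) ⊆ Ioo 0 T :=
      (tsupport_sub ψ (fun t => m * ρ t)).trans
        (union_subset hψs (hmρs.trans hρT))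
    have hmc : HasCompactSupport (fun t => m * ρ t) :=
      hρc.of_isClosed_subset (isClosed_tsupport _) hmρs
    have hmρ : ContDiff ℝ ∞ (fun t => m * ρ t) := contDiff_const.mul hρs
    have hψi : Integrable ψ := hψ.continuous.integrable_of_hasCompactSupport hψc
    obtain ⟨φ, h1, h2, h3, h4⟩ := exists_antideriv_testFunction hT (hψ.sub hmρ)
      (hψc.sub hmc) hsub (by
        rw [integral_sub hψi
          (hmρ.continuous.integrable_of_hasCompactSupport hmc), integral_const_mul, hρ1]
        simp [hm])
    have h5 := h φ h1 h2 h3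
    have h6 : ∫ t in Ioo 0 T, ψ t • z t = m • c := by
      rw [hc, ← integral_smul, ← sub_eq_zero, ← integral_sub
        (hint ψ hψ.continuous hψc hψs)]
      · rw [← h5, h4]
        refine integral_congr_ae (Filter.Eventually.of_forall fun t => ?_)
        simp only [sub_smul, mul_smul]
      · exact (hint ρ hρs.continuous hρc hρT).smul m
    have h7 : ∫ t, ψ t • (z t - c) = ∫ t in Ioo 0 T, ψ t • (z t - c) := by
      rw [setIntegral_eq_integral_of_forall_compl_eq_zero]
      intro x hx
      rw [image_eq_zero_of_notMem_tsupport fun h => hx (hψs h), zero_smul]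
    have h8 : ∫ t in Ioo 0 T, ψ t = m := by
      rw [setIntegral_eq_integral_of_forall_compl_eq_zero]
      intro x hx
      exact image_eq_zero_of_notMem_tsupport fun h => hx (hψs h)
    rw [h7]
    simp only [smul_sub]
    rw [integral_sub (hint ψ hψ.continuous hψc hψs), integral_smul_const, h6, h8, sub_self]
    exact (hψi.smul_const c).integrableOn
  rw [timeMeasure, ae_restrict_iff' measurableSet_Ioo]
  filter_upwards [key] with t ht h1
  exact sub_eq_zero.1 (ht h1)

/-- The difference of `u` and the primitive of `w` has weak derivative zero, so it is a constant,
and the initial value forces the constant to vanish. -/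
theorem ae_eq_primitive_of_hasWeakDeriv [CompleteSpace X] {T : ℝ} (hT : 0 < T) {u w : ℝ → X}
    (hw : IntegrableOn w (Ioo 0 T)) (h : HasWeakDeriv T u w) (h0 : VanishesAtZero T u) :
    ∀ᵐ t ∂(timeMeasure T), u t = ∫ τ in 0..t, w τ := by
  have hc := continuousOn_primitive_Ioo hT.le hw
  have hcl : LocallyIntegrableOn (fun t => ∫ τ in 0..t, w τ) (Ioo 0 T) :=
    ((hc.integrableOn_compact isCompact_Icc).mono_set Ioo_subset_Icc_self).locallyIntegrableOn
  obtain ⟨c, hcc⟩ := exists_ae_eq_const_of_integral_deriv_smul_eq_zero hT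
    (z := fun t => u t - ∫ τ in 0..t, w τ) (h.locallyIntegrable.sub hcl) (by
      intro φ h1 h2 h3
      have h4 : tsupport (deriv φ) ⊆ Ioo 0 T := tsupport_deriv_subset.trans h3
      have h5 : Continuous (deriv φ) := h1.continuous_deriv (by simp)
      simp only [smul_sub]
      rw [integral_sub (integrableOn_smul_of_tsupport_subset h.locallyIntegrable h5 h2.deriv h4)
        (integrableOn_smul_of_tsupport_subset hcl h5 h2.deriv h4), h.integral_eq φ h1 h2 h3,
        integral_deriv_smul_primitive hw h1 h2 h3, sub_self])
  obtain ⟨v, hv, huv, hv0⟩ := h0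
  have heq : ∀ᵐ t ∂(timeMeasure T), v t = c + ∫ τ in 0..t, w τ := by
    filter_upwards [hcc, huv] with t h1 h2
    rw [← h2, ← h1]; abel
  -- Two continuous functions that agree almost everywhere agree everywhere on `[0, T]`, in
  -- particular at the null set `{0}`.
  have hae : EqOn v (fun t => c + ∫ τ in 0..t, w τ) (Icc 0 T) := by
    refine Measure.eqOn_Icc_of_ae_eq (μ := volume) hT.ne ?_ hv (continuousOn_const.add hc)
    rw [Measure.restrict_congr_set Ioo_ae_eq_Icc.symm]
    exact heq
  have hc0 : c = 0 := by
    have := hae (left_mem_Icc.2 hT.le)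
    simpa [hv0] using this.symm
  filter_upwards [hcc] with t ht
  rw [hc0] at ht
  exact sub_eq_zero.1 ht

theorem HasWeakDeriv.ae_eq {T : ℝ} [CompleteSpace X] {u w₁ w₂ : ℝ → X} (h₁ : HasWeakDeriv T u w₁)
    (h₂ : HasWeakDeriv T u w₂) : w₁ =ᵐ[timeMeasure T] w₂ := by
  have key : ∀ᵐ t : ℝ, t ∈ Ioo 0 T → w₁ t - w₂ t = 0 := by
    refine isOpen_Ioo.ae_eq_zero_of_integral_contDiff_smul_eq_zero
      (h₁.locallyIntegrable_deriv.sub h₂.locallyIntegrable_deriv) ?_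
    intro ψ hψ hψc hψs
    have h7 : ∫ t, ψ t • (w₁ t - w₂ t) = ∫ t in Ioo 0 T, ψ t • (w₁ t - w₂ t) := by
      rw [setIntegral_eq_integral_of_forall_compl_eq_zero]
      intro x hx
      rw [image_eq_zero_of_notMem_tsupport fun h => hx (hψs h), zero_smul]
    rw [h7]
    simp only [smul_sub]
    rw [integral_sub
      (integrableOn_smul_of_tsupport_subset h₁.locallyIntegrable_deriv hψ.continuous hψc hψs)
      (integrableOn_smul_of_tsupport_subset h₂.locallyIntegrable_deriv hψ.continuous hψc hψs),
      sub_eq_zero, ← neg_inj, ← h₁.integral_eq ψ hψ hψc hψs, ← h₂.integral_eq ψ hψ hψc hψs]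
  rw [timeMeasure, Filter.EventuallyEq, ae_restrict_iff' measurableSet_Ioo]
  filter_upwards [key] with t ht h1
  exact sub_eq_zero.1 (ht h1)

end WeakDerivative

open Filter Topology ENNReal NNReal

instance instIsFiniteMeasureTimeMeasure (T : ℝ) : IsFiniteMeasure (timeMeasure T) := by
  unfold timeMeasure; infer_instance

theorem ae_timeMeasure_mem (T : ℝ) : ∀ᵐ t ∂(timeMeasure T), t ∈ Ioo 0 T :=
  ae_restrict_mem measurableSet_Ioo

/-! ### The Banach space of pairs and the parabolic operator -/

section MaxRegSpace

variable {D X : Type*} [NormedAddCommGroup D] [NormedSpace ℂ D]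
  [NormedAddCommGroup X] [NormedSpace ℂ X]

/-- Measurability of the family is only known on fixed vectors. It extends to simple functions by
additivity, and to limits by continuity of each `A t`. -/
theorem IsAdmissible.aestronglyMeasurable {ι : D →L[ℂ] X} {T : ℝ} {A : ℝ → D →L[ℂ] X}
    (hA : IsAdmissible ι T A) {u : ℝ → D} (hu : AEStronglyMeasurable u (timeMeasure T)) :
    AEStronglyMeasurable (fun t => A t (u t)) (timeMeasure T) := by
  obtain ⟨v, hv, huv⟩ := hu
  have hsimple : ∀ f : SimpleFunc ℝ D,
      AEStronglyMeasurable (fun t => A t (f t)) (timeMeasure T) := by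
    intro f
    induction f using SimpleFunc.induction with
    | @const c S hS =>
      refine ((hA.measurable c).indicator hS).congr (Eventually.of_forall fun t => ?_)
      by_cases ht : t ∈ S <;> simp [indicator, Set.piecewise, ht]
    | add _ hf hg =>
      refine (hf.add hg).congr (Eventually.of_forall fun t => ?_)
      simp
  refine AEStronglyMeasurable.congr ?_ (f := fun t => A t (v t)) ?_
  · exact aestronglyMeasurable_of_tendsto_ae atTop (fun n => hsimple (hv.approx n))
      (Eventually.of_forall fun t => ((A t).continuous.tendsto _).comp (hv.tendsto_approx t))
  · filter_upwards [huv] with t ht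
    rw [ht]

/-- The normalisation `1 ≤ C` later allows `12 + 8 * C` to be replaced by `20 * C`. -/
theorem IsAdmissible.exists_bound {ι : D →L[ℂ] X} {T : ℝ} {A : ℝ → D →L[ℂ] X}
    (hA : IsAdmissible ι T A) : ∃ C : ℝ, 1 ≤ C ∧
      ∀ u : ℝ → D, ∀ᵐ t ∂(timeMeasure T), ‖A t (u t)‖ ≤ C * ‖u t‖ := by
  obtain ⟨C, hC⟩ := hA.bounded
  refine ⟨max 1 C, le_max_left _ _, fun u => ?_⟩
  filter_upwards [ae_timeMeasure_mem T] with t ht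
  exact (A t).le_of_opNorm_le ((hC t ht).trans (le_max_right _ _)) _

theorem IsAdmissible.memLp {ι : D →L[ℂ] X} {T : ℝ} {A : ℝ → D →L[ℂ] X}
    (hA : IsAdmissible ι T A) {p : ℝ≥0∞} {u : ℝ → D} (hu : MemLp u p (timeMeasure T)) :
    MemLp (fun t => A t (u t)) p (timeMeasure T) := by
  obtain ⟨C, -, hC⟩ := hA.exists_bound
  exact hu.of_le_mul (hA.aestronglyMeasurable hu.1) (hC u)

/-- The superposition operator `u ↦ A(·) u(·)` from `L^p(J; D)` to `L^p(J; X)`. -/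
noncomputable def superposition {ι : D →L[ℂ] X} {T : ℝ} {A : ℝ → D →L[ℂ] X}
    (hA : IsAdmissible ι T A) (p : ℝ≥0∞) [Fact (1 ≤ p)] :
    Lp D p (timeMeasure T) →L[ℂ] Lp X p (timeMeasure T) :=
  LinearMap.mkContinuous
    { toFun := fun u => (hA.memLp (Lp.memLp u)).toLp _
      map_add' := fun u v => by
        apply Lp.ext
        filter_upwards [(hA.memLp (Lp.memLp (u + v))).coeFn_toLp,
          (hA.memLp (Lp.memLp u)).coeFn_toLp, (hA.memLp (Lp.memLp v)).coeFn_toLp,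
          Lp.coeFn_add u v, Lp.coeFn_add ((hA.memLp (Lp.memLp u)).toLp _)
            ((hA.memLp (Lp.memLp v)).toLp _)] with t h1 h2 h3 h4 h5
        rw [h1, h5, Pi.add_apply, h2, h3, h4, Pi.add_apply, map_add]
      map_smul' := fun c u => by
        apply Lp.ext
        filter_upwards [(hA.memLp (Lp.memLp (c • u))).coeFn_toLp,
          (hA.memLp (Lp.memLp u)).coeFn_toLp,
          Lp.coeFn_smul c u, Lp.coeFn_smul c ((hA.memLp (Lp.memLp u)).toLp _)] with t h1 h2 h4 h5
        rw [h1, RingHom.id_apply, h5, Pi.smul_apply, h2, h4, Pi.smul_apply, map_smul] }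
    hA.exists_bound.choose
    (fun u => by
      refine Lp.norm_le_mul_norm_of_ae_le_mul ?_
      filter_upwards [hA.exists_bound.choose_spec.2 u,
        (hA.memLp (Lp.memLp u)).coeFn_toLp] with t h1 h2
      simp only [LinearMap.coe_mk, AddHom.coe_mk]
      rw [h2]
      exact h1)

theorem coeFn_superposition {ι : D →L[ℂ] X} {T : ℝ} {A : ℝ → D →L[ℂ] X}
    (hA : IsAdmissible ι T A) (p : ℝ≥0∞) [Fact (1 ≤ p)] (u : Lp D p (timeMeasure T)) :
    superposition hA p u =ᵐ[timeMeasure T] fun t => A t (u t) :=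
  (hA.memLp (Lp.memLp u)).coeFn_toLp

theorem intervalIntegral_congr_timeMeasure {T t : ℝ} (ht : t ∈ Ioo 0 T) {w₁ w₂ : ℝ → X}
    (h : w₁ =ᵐ[timeMeasure T] w₂) : ∫ τ in 0..t, w₁ τ = ∫ τ in 0..t, w₂ τ := by
  rw [intervalIntegral.integral_of_le ht.1.le, intervalIntegral.integral_of_le ht.1.le]
  have hsub : Ioc 0 t ⊆ Ioo 0 T := fun x hx => ⟨hx.1, hx.2.trans_lt ht.2⟩
  exact integral_congr_ae (ae_restrict_of_ae_restrict_of_subset hsub h)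

theorem intervalIntegrable_of_timeMeasure {X : Type*} [NormedAddCommGroup X] {T t : ℝ} (ht : t ∈ Ioo 0 T) {w : ℝ → X}
    (h : Integrable w (timeMeasure T)) : IntervalIntegrable w volume 0 t := by
  rw [intervalIntegrable_iff_integrableOn_Ioc_of_le ht.1.le]
  exact IntegrableOn.mono_set h fun x hx => ⟨hx.1, hx.2.trans_lt ht.2⟩

/-- The space `MR_0^p(J; D, X)`, realised as the space of pairs `(u, u')`. -/
noncomputable def maxRegSpace (ι : D →L[ℂ] X) (T : ℝ) (p : ℝ≥0∞) [hp : Fact (1 ≤ p)] :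
    Submodule ℂ (Lp D p (timeMeasure T) × Lp X p (timeMeasure T)) where
  carrier := {x | ∀ᵐ t ∂(timeMeasure T), ι (x.1 t) = ∫ τ in 0..t, x.2 τ}
  add_mem' {x y} hx hy := by
    have h1 := (Lp.memLp x.2).integrable hp.out
    have h2 := (Lp.memLp y.2).integrable hp.out
    filter_upwards [hx, hy, Lp.coeFn_add x.1 y.1, ae_timeMeasure_mem T] with t h3 h4 h5 h6
    rw [Prod.fst_add, h5, Prod.snd_add,
      intervalIntegral_congr_timeMeasure h6 (Lp.coeFn_add x.2 y.2)]
    simp only [Pi.add_apply]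
    rw [map_add, h3, h4, intervalIntegral.integral_add (intervalIntegrable_of_timeMeasure h6 h1)
      (intervalIntegrable_of_timeMeasure h6 h2)]
  zero_mem' := by
    filter_upwards [Lp.coeFn_zero D p (timeMeasure T), ae_timeMeasure_mem T] with t h5 h6
    rw [Prod.fst_zero, h5, Prod.snd_zero,
      intervalIntegral_congr_timeMeasure h6 (Lp.coeFn_zero X p (timeMeasure T))]
    simp
  smul_mem' c x hx := by
    filter_upwards [hx, Lp.coeFn_smul c x.1, ae_timeMeasure_mem T] with t h3 h5 h6
    rw [Prod.smul_fst, h5, Prod.smul_snd,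
      intervalIntegral_congr_timeMeasure h6 (Lp.coeFn_smul c x.2)]
    simp only [Pi.smul_apply]
    rw [map_smul, h3, intervalIntegral.integral_smul]

theorem mem_maxRegSpace {ι : D →L[ℂ] X} {T : ℝ} {p : ℝ≥0∞} [Fact (1 ≤ p)]
    {x : Lp D p (timeMeasure T) × Lp X p (timeMeasure T)} :
    x ∈ maxRegSpace ι T p ↔ ∀ᵐ t ∂(timeMeasure T), ι (x.1 t) = ∫ τ in 0..t, x.2 τ := Iff.rfl

theorem toLp_mem_maxRegSpace {ι : D →L[ℂ] X} {T : ℝ} {p : ℝ≥0∞} [Fact (1 ≤ p)]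
    {u : ℝ → D} {w : ℝ → X} (hu : MemLp u p (timeMeasure T)) (hw : MemLp w p (timeMeasure T))
    (h : ∀ᵐ t ∂(timeMeasure T), ι (u t) = ∫ τ in 0..t, w τ) :
    (hu.toLp u, hw.toLp w) ∈ maxRegSpace ι T p := by
  rw [mem_maxRegSpace]
  filter_upwards [h, hu.coeFn_toLp, ae_timeMeasure_mem T] with t h1 h2 h3
  rw [h2, h1, intervalIntegral_congr_timeMeasure h3 hw.coeFn_toLp]

/-- The first components converge almost everywhere along a subsequence. The second ones converge in
`L^1`, because the measure is finite, so their primitives converge at every `t`. -/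
theorem isClosed_maxRegSpace (ι : D →L[ℂ] X) (T : ℝ) (p : ℝ≥0∞) [hp : Fact (1 ≤ p)] :
    IsClosed (maxRegSpace ι T p : Set (Lp D p (timeMeasure T) × Lp X p (timeMeasure T))) := by
  refine isClosed_of_closure_subset fun x hx => ?_
  obtain ⟨y, hy, hyx⟩ := mem_closure_iff_seq_limit.1 hx
  have hy1 : Tendsto (fun n => (y n).1) atTop (𝓝 x.1) := (continuous_fst.tendsto _).comp hyx
  have hy2 : Tendsto (fun n => (y n).2) atTop (𝓝 x.2) := (continuous_snd.tendsto _).comp hyx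
  obtain ⟨k, hk, hkt⟩ := (tendstoInMeasure_of_tendsto_Lp hy1).exists_seq_tendsto_ae
  have hint : ∀ t ∈ Ioo 0 T, Tendsto (fun n => ∫ τ in 0..t, (y n).2 τ) atTop
      (𝓝 (∫ τ in 0..t, x.2 τ)) := by
    intro t ht
    have hsub : Ioc 0 t ⊆ Ioo 0 T := fun z hz => ⟨hz.1, hz.2.trans_lt ht.2⟩
    simp only [intervalIntegral.integral_of_le ht.1.le]
    have h1 : Tendsto (fun n => eLpNorm (⇑(y n).2 - ⇑x.2) 1 (timeMeasure T)) atTop (𝓝 0) := by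
      have h2 := (Lp.tendsto_Lp_iff_tendsto_eLpNorm' _ _).1 hy2
      have h3 := ENNReal.Tendsto.mul_const (b :=
        (timeMeasure T) univ ^ (1 / (1 : ℝ≥0∞).toReal - 1 / p.toReal)) h2 (Or.inr (by
          refine ENNReal.rpow_ne_top_of_nonneg ?_ (measure_ne_top _ _)
          rw [sub_nonneg]
          -- For `p = ⊤` the exponent is correct because `(⊤ : ℝ≥0∞).toReal = 0` and `1 / 0 = 0`.
          rcases eq_or_ne p ⊤ with rfl | hpt
          · simp
          · have : 1 ≤ p.toReal := by
              simpa using ENNReal.toReal_mono hpt hp.out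
            simpa using inv_le_one_of_one_le₀ this))
      rw [zero_mul] at h3
      refine tendsto_of_tendsto_of_tendsto_of_le_of_le tendsto_const_nhds h3
        (fun _ => zero_le) fun n => ?_
      exact eLpNorm_le_eLpNorm_mul_rpow_measure_univ hp.out
        ((Lp.aestronglyMeasurable _).sub (Lp.aestronglyMeasurable _))
    have h4 := tendsto_setIntegral_of_L1' (μ := timeMeasure T) x.2
      (Lp.aestronglyMeasurable x.2) (Eventually.of_forall fun n =>
        (Lp.memLp (y n).2).integrable hp.out) h1 (Ioc 0 t)
    have hm : (timeMeasure T).restrict (Ioc 0 t) = volume.restrict (Ioc 0 t) :=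
      Measure.restrict_restrict_of_subset hsub
    simpa only [hm] using h4
  rw [SetLike.mem_coe, mem_maxRegSpace]
  have hall : ∀ᵐ t ∂(timeMeasure T), ∀ n, ι ((y n).1 t) = ∫ τ in 0..t, (y n).2 τ :=
    ae_all_iff.2 fun n => hy n
  filter_upwards [hall, hkt, ae_timeMeasure_mem T] with t h1 h2 h3
  refine tendsto_nhds_unique ((ι.continuous.tendsto _).comp h2) ?_
  exact ((hint t h3).comp hk.tendsto_atTop).congr fun n => (h1 _).symm

instance instCompleteSpaceMaxRegSpace [CompleteSpace D] [CompleteSpace X] (ι : D →L[ℂ] X) (T : ℝ)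
    (p : ℝ≥0∞) [Fact (1 ≤ p)] : CompleteSpace (maxRegSpace ι T p) :=
  (isClosed_maxRegSpace ι T p).completeSpace_coe

/-- The parabolic operator `u ↦ u' + A(·) u` from `MR_0^p(J; D, X)` to `L^p(J; X)`. -/
noncomputable def parabolicOp {ι : D →L[ℂ] X} {T : ℝ} {A : ℝ → D →L[ℂ] X}
    (hA : IsAdmissible ι T A) (p : ℝ≥0∞) [Fact (1 ≤ p)] :
    maxRegSpace ι T p →L[ℂ] Lp X p (timeMeasure T) :=
  (ContinuousLinearMap.snd ℂ _ _ +
    (superposition hA p).comp (ContinuousLinearMap.fst ℂ _ _)).comp (maxRegSpace ι T p).subtypeL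

theorem coeFn_parabolicOp {ι : D →L[ℂ] X} {T : ℝ} {A : ℝ → D →L[ℂ] X}
    (hA : IsAdmissible ι T A) (p : ℝ≥0∞) [Fact (1 ≤ p)] (x : maxRegSpace ι T p) :
    parabolicOp hA p x =ᵐ[timeMeasure T] fun t => x.1.2 t + A t (x.1.1 t) := by
  filter_upwards [coeFn_superposition hA p x.1.1,
    Lp.coeFn_add x.1.2 (superposition hA p x.1.1)] with t h1 h2
  change (x.1.2 + superposition hA p x.1.1 : Lp X p (timeMeasure T)) t = _
  rw [h2, Pi.add_apply, h1]

/-- Distributional derivative and initial condition merge into a single integral identity, which is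
the only form used from here on. -/
theorem memMR_and_solvesAE_iff [CompleteSpace X] {ι : D →L[ℂ] X} {T : ℝ} (hT : 0 < T) {s : ℝ}
    (hs : 1 ≤ s) {A : ℝ → D →L[ℂ] X} {u : ℝ → D} {f : ℝ → X} :
    MemMR ι T s u ∧ SolvesAE ι T A u f ↔
      MemLp u (ENNReal.ofReal s) (timeMeasure T) ∧
      ∃ w : ℝ → X, MemLp w (ENNReal.ofReal s) (timeMeasure T) ∧
        (∀ᵐ t ∂(timeMeasure T), ι (u t) = ∫ τ in 0..t, w τ) ∧
        ∀ᵐ t ∂(timeMeasure T), w t + A t (u t) = f t := by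
  have hp : 1 ≤ ENNReal.ofReal s := by simpa using ENNReal.ofReal_le_ofReal hs
  constructor
  · rintro ⟨⟨hu, ⟨-, w, hw, hd⟩, h0⟩, w', hw', hs'⟩
    refine ⟨hu, w, hw, ae_eq_primitive_of_hasWeakDeriv hT (MemLp.integrable hp hw) hd h0, ?_⟩
    filter_upwards [hd.ae_eq hw', hs'] with t h1 h2
    rw [h1, h2]
  · rintro ⟨hu, w, hw, hd, hs'⟩
    obtain ⟨h1, h2⟩ := hasWeakDeriv_of_primitive hT.le (MemLp.integrable hp hw) hd
    exact ⟨⟨hu, ⟨ι.comp_memLp' hu, w, hw, h1⟩, h2⟩, w, h1, hs'⟩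

/-- This turns a statement about almost everywhere classes into one about a bounded operator between
Banach spaces, where the open mapping theorem and density arguments apply. -/
theorem hasMaxReg_iff_bijective [CompleteSpace X] {ι : D →L[ℂ] X} {T : ℝ} (hT : 0 < T) {s : ℝ}
    [Fact (1 ≤ ENNReal.ofReal s)] (hs : 1 ≤ s) {A : ℝ → D →L[ℂ] X} (hA : IsAdmissible ι T A) :
    HasMaxReg ι T s A ↔ Function.Bijective (parabolicOp hA (ENNReal.ofReal s)) := by
  have hsol : ∀ x : maxRegSpace ι T (ENNReal.ofReal s), ∀ f : ℝ → X,
      parabolicOp hA _ x =ᵐ[timeMeasure T] f → MemMR ι T s x.1.1 ∧ SolvesAE ι T A x.1.1 f := by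
    intro x f hf
    refine (memMR_and_solvesAE_iff hT hs).2 ⟨Lp.memLp _, x.1.2, Lp.memLp _, x.2, ?_⟩
    filter_upwards [coeFn_parabolicOp hA _ x, hf] with t h1 h2
    rw [← h1, h2]
  have hlift : ∀ u : ℝ → D, ∀ f : ℝ → X, MemMR ι T s u ∧ SolvesAE ι T A u f →
      ∃ x : maxRegSpace ι T (ENNReal.ofReal s), x.1.1 =ᵐ[timeMeasure T] u ∧
        parabolicOp hA _ x =ᵐ[timeMeasure T] f := by
    intro u f huf
    obtain ⟨hu, w, hw, hd, hs'⟩ := (memMR_and_solvesAE_iff hT hs).1 huf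
    refine ⟨⟨_, toLp_mem_maxRegSpace hu hw hd⟩, hu.coeFn_toLp, ?_⟩
    filter_upwards [coeFn_parabolicOp hA _ ⟨_, toLp_mem_maxRegSpace hu hw hd⟩, hu.coeFn_toLp,
      hw.coeFn_toLp, hs'] with t h1 h2 h3 h4
    rw [h1, h2, h3, h4]
  constructor
  · intro h
    refine ⟨(injective_iff_map_eq_zero _).2 fun x hx => ?_, fun g => ?_⟩
    · have h1 := hsol x 0 (by rw [hx]; exact Lp.coeFn_zero _ _ _)
      have h2 := hsol 0 0 (by rw [map_zero]; exact Lp.coeFn_zero _ _ _)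
      obtain ⟨u, -, hu⟩ := h.exists_unique 0 MemLp.zero
      have h3 : x.1.1 = 0 := Lp.ext ((hu _ h1).trans (hu _ h2).symm)
      have h4 : x.1.2 = 0 := by
        apply Lp.ext
        filter_upwards [coeFn_parabolicOp hA _ x, Lp.coeFn_zero X (ENNReal.ofReal s) (timeMeasure T),
          Lp.coeFn_zero D (ENNReal.ofReal s) (timeMeasure T)] with t h5 h6 h7
        rw [hx, h3, h6, h7] at h5
        rw [h6]
        simpa using h5.symm
      exact Subtype.ext (Prod.ext h3 h4)
    · obtain ⟨u, hu, -⟩ := h.exists_unique g (Lp.memLp g)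
      obtain ⟨x, -, hx⟩ := hlift u g hu
      exact ⟨x, Lp.ext hx⟩
  · intro h
    refine ⟨hA, fun f hf => ?_⟩
    obtain ⟨x, hx⟩ := h.2 (MemLp.toLp f hf)
    have hxf : parabolicOp hA _ x =ᵐ[timeMeasure T] f := by
      rw [hx]; exact MemLp.coeFn_toLp hf
    refine ⟨x.1.1, hsol x f hxf, fun v hv => ?_⟩
    obtain ⟨y, hy1, hy2⟩ := hlift v f hv
    have : y = x := h.1 (Lp.ext (hy2.trans hxf.symm))
    rw [← this]
    exact hy1.symm

end MaxRegSpace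

/-! ### The uncentred maximal function on the line -/

section MaximalFunction

/-- The set where the uncentred maximal function of `h` exceeds `l`. -/
def maximalSet (h : ℝ → ℝ) (l : ℝ) : Set ℝ :=
  ⋃ q ∈ {q : ℝ × ℝ | 0 < q.2 ∧ l * (2 * q.2) < ∫ t in Metric.ball q.1 q.2, h t},
    Metric.ball q.1 q.2

theorem isOpen_maximalSet (h : ℝ → ℝ) (l : ℝ) : IsOpen (maximalSet h l) :=
  isOpen_biUnion fun _ _ => Metric.isOpen_ball

theorem setIntegral_ball_le_of_notMem_maximalSet {h : ℝ → ℝ} {l t : ℝ}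
    (ht : t ∉ maximalSet h l) {c ρ : ℝ} (hρ : 0 < ρ) (htc : t ∈ Metric.ball c ρ) :
    ∫ τ in Metric.ball c ρ, h τ ≤ l * (2 * ρ) := by
  by_contra hlt
  exact ht (mem_biUnion (x := (c, ρ)) ⟨hρ, not_le.1 hlt⟩ htc)

/-- By Lebesgue differentiation, `h t` is almost everywhere the limit of averages over balls centred
at `t`, each of which is at most `l`. -/
theorem ae_le_of_notMem_maximalSet {h : ℝ → ℝ} (hh : Integrable h) (l : ℝ) :
    ∀ᵐ t : ℝ, t ∉ maximalSet h l → h t ≤ l := by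
  filter_upwards [IsUnifLocDoublingMeasure.ae_tendsto_average volume hh.locallyIntegrable 1]
    with t ht hn
  have hδ : Tendsto (fun δ : ℝ => δ) (𝓝[>] 0) (𝓝[>] 0) := tendsto_id
  have h1 := ht (fun _ => t) (fun δ => δ) hδ (by
    filter_upwards [self_mem_nhdsWithin] with δ hδ
    exact Metric.mem_closedBall_self (by rw [one_mul]; exact (mem_Ioi.1 hδ).le))
  refine le_of_tendsto h1 ?_
  filter_upwards [self_mem_nhdsWithin] with δ hδ
  have hδ : 0 < δ := hδ
  rw [setAverage_eq, Measure.real, Real.volume_closedBall, ENNReal.toReal_ofReal (by positivity),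
    smul_eq_mul, inv_mul_le_iff₀ (by positivity), mul_comm]
  have : ∫ τ in Metric.closedBall t δ, h τ = ∫ τ in Metric.ball t δ, h τ := by
    rw [Real.closedBall_eq_Icc, Real.ball_eq_Ioo, integral_Icc_eq_integral_Ioo]
  rw [this]
  exact setIntegral_ball_le_of_notMem_maximalSet hn hδ (Metric.mem_ball_self hδ)

/-- Vitali covering gives disjoint balls with union `V` whose fivefold enlargements cover the set,
and `l |V| ≤ ∫_V h`. The part of `V` where `h ≤ l / 2` contributes at most half of the left side and
is absorbed, so only `{l / 2 < h}` remains; this sharpening of the weak type bound is what makes the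
later integration in `l` converge. -/
theorem volume_maximalSet_le {h : ℝ → ℝ} (hh : Integrable h) (h0 : 0 ≤ h) {l : ℝ} (hl : 0 < l) :
    volume (maximalSet h l) ≤
      ENNReal.ofReal (10 / l) * ∫⁻ t in {t | l / 2 < h t}, ENNReal.ofReal (h t) := by
  set Q : Set (ℝ × ℝ) := {q | 0 < q.2 ∧ l * (2 * q.2) < ∫ t in Metric.ball q.1 q.2, h t} with hQ
  have hQR : ∀ q ∈ Q, q.2 ≤ (∫ t, h t) / l := by
    intro q hq
    rw [le_div_iff₀ hl]
    have h1 : ∫ t in Metric.ball q.1 q.2, h t ≤ ∫ t, h t :=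
      setIntegral_le_integral hh (Eventually.of_forall h0)
    nlinarith [hq.1, hq.2]
  obtain ⟨U, hUQ, hUd, hUc⟩ := Vitali.exists_disjoint_subfamily_covering_enlargement_ball
    Q (fun q => q.1) (fun q => q.2) _ hQR 5 (by norm_num)
  have hUcount : U.Countable := hUd.countable_of_isOpen (fun _ _ => Metric.isOpen_ball)
    (fun q hq => Metric.nonempty_ball.2 (hUQ hq).1)
  have : Countable U := hUcount.to_subtype
  set V : Set ℝ := ⋃ q : U, Metric.ball q.1.1 q.1.2 with hV
  have hVm : MeasurableSet V := MeasurableSet.iUnion fun _ => measurableSet_ball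
  have hdis : Pairwise (Function.onFun Disjoint fun q : U => Metric.ball q.1.1 q.1.2) :=
    fun a b hab => hUd a.2 b.2 (fun h => hab (Subtype.ext h))
  have hVvol : volume V = ∑' q : U, ENNReal.ofReal (2 * q.1.2) := by
    rw [hV, measure_iUnion hdis fun _ => measurableSet_ball]
    simp [Real.volume_ball]
  have hVint : ∫⁻ t in V, ENNReal.ofReal (h t) =
      ∑' q : U, ∫⁻ t in Metric.ball q.1.1 q.1.2, ENNReal.ofReal (h t) := by
    rw [hV, lintegral_iUnion (fun _ => measurableSet_ball) hdis]
  have hOV : volume (maximalSet h l) ≤ 5 * volume V := by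
    have hsub : maximalSet h l ⊆ ⋃ q : U, Metric.ball q.1.1 (5 * q.1.2) := by
      refine iUnion₂_subset fun q hq => ?_
      obtain ⟨b, hb, hqb⟩ := hUc q hq
      exact hqb.trans (subset_iUnion (fun q : U => Metric.ball q.1.1 (5 * q.1.2)) ⟨b, hb⟩)
    refine (measure_mono hsub).trans ((measure_iUnion_le _).trans_eq ?_)
    rw [hVvol, ← ENNReal.tsum_mul_left]
    refine tsum_congr fun q => ?_
    rw [Real.volume_ball, ← ENNReal.ofReal_ofNat 5, ← ENNReal.ofReal_mul (by norm_num)]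
    congr 1; ring
  have hfin : ∫⁻ t in V, ENNReal.ofReal (h t) ≠ ⊤ :=
    ((setLIntegral_le_lintegral _ _).trans_lt hh.lintegral_lt_top).ne
  have hlV : ENNReal.ofReal l * volume V ≤ ∫⁻ t in V, ENNReal.ofReal (h t) := by
    rw [hVvol, hVint, ← ENNReal.tsum_mul_left]
    refine ENNReal.tsum_le_tsum fun q => ?_
    rw [← ENNReal.ofReal_mul hl.le, ← ofReal_integral_eq_lintegral_ofReal hh.integrableOn
      (Eventually.of_forall h0)]
    exact ENNReal.ofReal_le_ofReal (hUQ q.2).2.le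
  -- the part of the integral where `h ≤ l / 2` is absorbed
  have hsplit : ∫⁻ t in V, ENNReal.ofReal (h t) ≤
      (∫⁻ t in {t | l / 2 < h t}, ENNReal.ofReal (h t)) + ENNReal.ofReal (l / 2) * volume V := by
    have hpt : ∀ t, ENNReal.ofReal (h t) ≤
        {t | l / 2 < h t}.indicator (fun t => ENNReal.ofReal (h t)) t + ENNReal.ofReal (l / 2) := by
      intro t
      by_cases ht : l / 2 < h t
      · rw [indicator_of_mem (show t ∈ {t | l / 2 < h t} from ht)]
        exact le_self_add
      · exact (ENNReal.ofReal_le_ofReal (not_lt.1 ht)).trans le_add_self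
    have hns : NullMeasurableSet {t | l / 2 < h t} :=
      nullMeasurableSet_lt aemeasurable_const hh.aemeasurable
    calc ∫⁻ t in V, ENNReal.ofReal (h t)
        ≤ ∫⁻ t in V, ({t | l / 2 < h t}.indicator (fun t => ENNReal.ofReal (h t)) t +
            ENNReal.ofReal (l / 2)) := lintegral_mono hpt
      _ = (∫⁻ t in V, ({t | l / 2 < h t}.indicator (fun t => ENNReal.ofReal (h t)) t)) +
            ENNReal.ofReal (l / 2) * volume V := by
          rw [lintegral_add_right _ measurable_const, setLIntegral_const]
      _ ≤ _ := by
          refine add_le_add ((setLIntegral_le_lintegral _ _).trans ?_) le_rfl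
          rw [lintegral_indicator₀ hns]
  have hhalf : ENNReal.ofReal (l / 2) * volume V ≤
      ∫⁻ t in {t | l / 2 < h t}, ENNReal.ofReal (h t) := by
    have hVfin : ENNReal.ofReal (l / 2) * volume V ≠ ⊤ := by
      refine ENNReal.mul_ne_top ENNReal.ofReal_ne_top fun htop => ?_
      rw [htop, ENNReal.mul_top (by simpa using hl)] at hlV
      exact hfin (top_le_iff.1 hlV)
    have h1 := hlV.trans hsplit
    have h2 : ENNReal.ofReal l = ENNReal.ofReal (l / 2) + ENNReal.ofReal (l / 2) := by
      rw [← ENNReal.ofReal_add (by positivity) (by positivity), add_halves]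
    rw [h2, add_mul] at h1
    exact (ENNReal.add_le_add_iff_right hVfin).1 h1
  calc volume (maximalSet h l) ≤ 5 * volume V := hOV
    _ = ENNReal.ofReal (10 / l) * (ENNReal.ofReal (l / 2) * volume V) := by
        rw [← mul_assoc, ← ENNReal.ofReal_mul (by positivity)]
        congr 1
        rw [show 10 / l * (l / 2) = 5 by field_simp; norm_num]
        simp
    _ ≤ _ := by gcongr

end MaximalFunction

/-! ### Change of variables for increasing absolutely continuous maps -/

section ChangeOfVariables

/-- Measures on the line are determined by intervals, and on intervals the claim is the integral
formula `hy`. No pointwise differentiability of `y` is required, which suits a merely Lipschitz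
radius. -/
theorem measurePreserving_withDensity_orderIso (y : ℝ ≃o ℝ) {y' : ℝ → ℝ}
    (hi : ∀ a b, IntervalIntegrable y' volume a b) (h0 : 0 ≤ y')
    (hy : ∀ a b, ∫ t in a..b, y' t = y b - y a) :
    MeasurePreserving y (volume.withDensity fun t => ENNReal.ofReal (y' t)) volume := by
  refine ⟨y.continuous.measurable, ?_⟩
  have key : ∀ a b : ℝ, (volume.withDensity fun t => ENNReal.ofReal (y' t)).map y (Ioo a b) =
      volume (Ioo a b) := by
    intro a b
    rw [Measure.map_apply y.continuous.measurable measurableSet_Ioo, y.preimage_Ioo,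
      withDensity_apply _ measurableSet_Ioo, Real.volume_Ioo]
    rcases le_or_gt a b with hab | hab
    · have hab' : y.symm a ≤ y.symm b := y.symm.monotone hab
      rw [← ofReal_integral_eq_lintegral_ofReal _ (Eventually.of_forall h0),
        ← integral_Ioc_eq_integral_Ioo, ← intervalIntegral.integral_of_le hab', hy]
      · simp
      · exact ((intervalIntegrable_iff_integrableOn_Ioc_of_le hab').1 (hi _ _)).mono_set
          Ioo_subset_Ioc_self
    · rw [Ioo_eq_empty (by simpa using hab.le)]
      simp [ENNReal.ofReal_of_nonpos (sub_nonpos.2 hab.le)]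
  exact (Real.measure_ext_Ioo_rat (μ := volume) fun a b => (key a b).symm).symm

variable {E : Type*} [NormedAddCommGroup E] [NormedSpace ℝ E]

theorem lintegral_ofReal_mul_comp_orderIso (y : ℝ ≃o ℝ) {y' : ℝ → ℝ} (hm : Measurable y')
    (hi : ∀ a b, IntervalIntegrable y' volume a b) (h0 : 0 ≤ y')
    (hy : ∀ a b, ∫ t in a..b, y' t = y b - y a) {f : ℝ → ℝ≥0∞} (hf : Measurable f) :
    ∫⁻ t, ENNReal.ofReal (y' t) * f (y t) = ∫⁻ t, f t := by
  rw [← (measurePreserving_withDensity_orderIso y hi h0 hy).lintegral_comp hf]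
  exact (lintegral_withDensity_eq_lintegral_mul _ hm.ennreal_ofReal
    (hf.comp y.continuous.measurable)).symm

theorem setIntegral_Iic_smul_comp_orderIso (y : ℝ ≃o ℝ) {y' : ℝ → ℝ} (hm : Measurable y')
    (hi : ∀ a b, IntervalIntegrable y' volume a b) (h0 : 0 ≤ y')
    (hy : ∀ a b, ∫ t in a..b, y' t = y b - y a) (f : ℝ → E) (c : ℝ) :
    ∫ t in Iic c, y' t • f (y t) = ∫ t in Iic (y c), f t := by
  rw [← (measurePreserving_withDensity_orderIso y hi h0 hy).setIntegral_preimage_emb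
    y.toHomeomorph.measurableEmbedding f, y.preimage_Iic, y.symm_apply_apply,
    setIntegral_withDensity_eq_setIntegral_toReal_smul hm.ennreal_ofReal
      (Eventually.of_forall fun _ => ENNReal.ofReal_lt_top) _ measurableSet_Iic]
  refine setIntegral_congr_fun measurableSet_Iic fun t _ => ?_
  rw [ENNReal.toReal_ofReal (h0 t)]

end ChangeOfVariables

/-! ### Averages with variable radius -/

section Smoothing

variable {ρ : ℝ → ℝ}

/-- The perturbation `σ * ρ` is `1/2`-Lipschitz, so the map increases with slope at least `1/2` and
tends to infinity at both ends. -/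
theorem exists_orderIso_sub_mul (hρ : LipschitzWith (1 / 2) ρ) {σ : ℝ} (hσ : σ ∈ Ioo (0 : ℝ) 1) :
    ∃ y : ℝ ≃o ℝ, ∀ t, y t = t - σ * ρ t := by
  have hd : ∀ s t, |ρ s - ρ t| ≤ 1 / 2 * |s - t| := fun s t => by
    simpa [Real.dist_eq] using hρ.dist_le_mul s t
  have hc : Continuous fun t => t - σ * ρ t := continuous_id.sub (continuous_const.mul hρ.continuous)
  have hbound : ∀ s t, |σ * (ρ s - ρ t)| ≤ 1 / 2 * |s - t| := by
    intro s t
    rw [abs_mul, abs_of_pos hσ.1]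
    nlinarith [hd s t, abs_nonneg (ρ s - ρ t), hσ.2, hσ.1]
  have hmono : StrictMono fun t => t - σ * ρ t := by
    intro s t hst
    have h1 := (le_abs_self _).trans (hbound t s)
    rw [abs_of_pos (sub_pos.2 hst)] at h1
    simp only
    linarith
  have htop : Tendsto (fun t => t - σ * ρ t) atTop atTop := by
    refine tendsto_atTop_mono' atTop (f₁ := fun t => 1 / 2 * t - σ * ρ 0) ?_ ?_
    · filter_upwards [eventually_ge_atTop 0] with t ht
      have h1 := (le_abs_self _).trans (hbound t 0)
      rw [sub_zero, abs_of_nonneg ht] at h1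
      linarith
    · exact tendsto_atTop_add_const_right _ _ (tendsto_id.const_mul_atTop (by norm_num))
  have hbot : Tendsto (fun t => t - σ * ρ t) atBot atBot := by
    refine tendsto_atBot_mono' atBot (f₁ := fun t => 1 / 2 * t - σ * ρ 0) ?_ ?_
    · filter_upwards [eventually_le_atBot 0] with t ht
      have h1 := (neg_abs_le _).trans' (neg_le_neg (hbound t 0))
      rw [sub_zero, abs_of_nonpos ht] at h1
      linarith
    · exact tendsto_atBot_add_const_right _ _ (tendsto_id.const_mul_atBot (by norm_num))
  exact ⟨hmono.orderIsoOfSurjective _ (hc.surjective htop hbot), fun t => rfl⟩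

theorem abs_deriv_le_half (hρ : LipschitzWith (1 / 2) ρ) (t : ℝ) : |deriv ρ t| ≤ 1 / 2 := by
  simpa using norm_deriv_le_of_lipschitz hρ (x₀ := t)

theorem intervalIntegrable_deriv_lipschitz (hρ : LipschitzWith (1 / 2) ρ) (a b : ℝ) :
    IntervalIntegrable (deriv ρ) volume a b :=
  (intervalIntegrable_const (c := (1 / 2 : ℝ))).mono_fun
    (measurable_deriv ρ).aestronglyMeasurable
    (Eventually.of_forall fun t => by simpa using abs_deriv_le_half hρ t)

theorem intervalIntegrable_one_sub_mul_deriv (hρ : LipschitzWith (1 / 2) ρ) (σ a b : ℝ) :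
    IntervalIntegrable (fun t => 1 - σ * deriv ρ t) volume a b :=
  intervalIntegrable_const.sub ((intervalIntegrable_deriv_lipschitz hρ a b).const_mul σ)

theorem integral_one_sub_mul_deriv (hρ : LipschitzWith (1 / 2) ρ) (σ a b : ℝ) :
    ∫ t in a..b, (1 - σ * deriv ρ t) = (b - σ * ρ b) - (a - σ * ρ a) := by
  rw [intervalIntegral.integral_sub intervalIntegrable_const
    ((intervalIntegrable_deriv_lipschitz hρ a b).const_mul σ), intervalIntegral.integral_const_mul,
    (hρ.lipschitzOnWith (s := uIcc a b)).absolutelyContinuousOnInterval.integral_deriv_eq_sub]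
  simp
  ring

theorem one_sub_mul_deriv_mem (hρ : LipschitzWith (1 / 2) ρ) {σ : ℝ} (hσ : σ ∈ Ioo (0 : ℝ) 1)
    (t : ℝ) : 1 - σ * deriv ρ t ∈ Icc (0 : ℝ) (3 / 2) := by
  have h1 : |σ * deriv ρ t| ≤ 1 / 2 := by
    rw [abs_mul, abs_of_pos hσ.1]
    nlinarith [abs_deriv_le_half hρ t, abs_nonneg (deriv ρ t), hσ.1, hσ.2]
  have := abs_le.1 h1
  constructor <;> linarith [this.1, this.2]

variable {E : Type*} [NormedAddCommGroup E] [NormedSpace ℝ E]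

/-- The average of `u` over the interval `(t - ρ t, t)`. -/
noncomputable def smoothing (ρ : ℝ → ℝ) (u : ℝ → E) (t : ℝ) : E :=
  ∫ σ in Ioo (0 : ℝ) 1, u (t - σ * ρ t)

/-- The derivative of the smoothing of a primitive of `w`. -/
noncomputable def smoothingDeriv (ρ : ℝ → ℝ) (w : ℝ → E) (t : ℝ) : E :=
  ∫ σ in Ioo (0 : ℝ) 1, (1 - σ * deriv ρ t) • w (t - σ * ρ t)

theorem stronglyMeasurable_smoothing (hρ : LipschitzWith (1 / 2) ρ) {u : ℝ → E}
    (hu : StronglyMeasurable u) : StronglyMeasurable (smoothing ρ u) := by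
  have hm : Measurable fun p : ℝ × ℝ => p.1 - p.2 * ρ p.1 :=
    measurable_fst.sub (measurable_snd.mul (hρ.continuous.measurable.comp measurable_fst))
  exact StronglyMeasurable.integral_prod_right (f := fun t σ => u (t - σ * ρ t))
    (hu.comp_measurable hm)

theorem stronglyMeasurable_smoothingDeriv_kernel (hρ : LipschitzWith (1 / 2) ρ) {w : ℝ → E}
    (hw : StronglyMeasurable w) :
    StronglyMeasurable fun p : ℝ × ℝ => (1 - p.2 * deriv ρ p.1) • w (p.1 - p.2 * ρ p.1) := by
  have hm : Measurable fun p : ℝ × ℝ => p.1 - p.2 * ρ p.1 :=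
    measurable_fst.sub (measurable_snd.mul (hρ.continuous.measurable.comp measurable_fst))
  have hm2 : Measurable fun p : ℝ × ℝ => 1 - p.2 * deriv ρ p.1 :=
    measurable_const.sub (measurable_snd.mul ((measurable_deriv ρ).comp measurable_fst))
  exact hm2.stronglyMeasurable.smul (hw.comp_measurable hm)

theorem stronglyMeasurable_smoothingDeriv (hρ : LipschitzWith (1 / 2) ρ) {w : ℝ → E}
    (hw : StronglyMeasurable w) : StronglyMeasurable (smoothingDeriv ρ w) :=
  StronglyMeasurable.integral_prod_right
    (f := fun t σ => (1 - σ * deriv ρ t) • w (t - σ * ρ t))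
    (stronglyMeasurable_smoothingDeriv_kernel hρ hw)

/-- For each fixed `σ` the factor `1 - σ * deriv ρ t` is the Jacobian of `t ↦ t - σ * ρ t`, so the
integral of the norm over `t` equals that of `w`. -/
theorem integrable_smoothingDeriv_kernel (hρ : LipschitzWith (1 / 2) ρ) {w : ℝ → E}
    (hwm : StronglyMeasurable w) (hw : Integrable w) :
    Integrable (fun p : ℝ × ℝ => (1 - p.2 * deriv ρ p.1) • w (p.1 - p.2 * ρ p.1))
      ((volume : Measure ℝ).prod (volume.restrict (Ioo 0 1))) := by
  have hsm := stronglyMeasurable_smoothingDeriv_kernel hρ hwm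
  refine ⟨hsm.aestronglyMeasurable, ?_⟩
  rw [hasFiniteIntegral_iff_enorm, lintegral_prod_symm _ hsm.enorm.aemeasurable]
  have h1 : ∀ σ ∈ Ioo (0 : ℝ) 1,
      ∫⁻ t, ‖(1 - σ * deriv ρ t) • w (t - σ * ρ t)‖ₑ = ∫⁻ t, ‖w t‖ₑ := by
    intro σ hσ
    obtain ⟨y, hy⟩ := exists_orderIso_sub_mul hρ hσ
    rw [← lintegral_ofReal_mul_comp_orderIso y (y' := fun t => 1 - σ * deriv ρ t)
      (measurable_const.sub (measurable_const.mul (measurable_deriv ρ)))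
      (intervalIntegrable_one_sub_mul_deriv hρ σ) (fun t => (one_sub_mul_deriv_mem hρ hσ t).1)
      (fun a b => by rw [integral_one_sub_mul_deriv hρ, hy, hy]) hwm.enorm]
    refine lintegral_congr fun t => ?_
    rw [enorm_smul, hy, Real.enorm_of_nonneg (one_sub_mul_deriv_mem hρ hσ t).1]
  simp only
  rw [setLIntegral_congr_fun measurableSet_Ioo h1, setLIntegral_const]
  exact ENNReal.mul_lt_top hw.hasFiniteIntegral (by simp)

theorem integrable_smoothingDeriv (hρ : LipschitzWith (1 / 2) ρ) {w : ℝ → E}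
    (hwm : StronglyMeasurable w) (hw : Integrable w) : Integrable (smoothingDeriv ρ w) :=
  (integrable_smoothingDeriv_kernel hρ hwm hw).integral_prod_left

/-- Fubini and the change of variables for each `σ`. This identifies the average of the primitive as
a primitive without differentiating an average. -/
theorem setIntegral_Iic_smoothingDeriv [CompleteSpace E] (hρ : LipschitzWith (1 / 2) ρ) {w : ℝ → E}
    (hwm : StronglyMeasurable w) (hw : Integrable w) (t : ℝ) :
    ∫ τ in Iic t, smoothingDeriv ρ w τ =
      ∫ σ in Ioo (0 : ℝ) 1, ∫ τ in Iic (t - σ * ρ t), w τ := by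
  unfold smoothingDeriv
  rw [integral_integral_swap]
  · refine setIntegral_congr_fun measurableSet_Ioo fun σ hσ => ?_
    obtain ⟨y, hy⟩ := exists_orderIso_sub_mul hρ hσ
    have := setIntegral_Iic_smul_comp_orderIso y (y' := fun t => 1 - σ * deriv ρ t)
      (measurable_const.sub (measurable_const.mul (measurable_deriv ρ)))
      (intervalIntegrable_one_sub_mul_deriv hρ σ) (fun t => (one_sub_mul_deriv_mem hρ hσ t).1)
      (fun a b => by rw [integral_one_sub_mul_deriv hρ, hy, hy]) w t
    simp only [hy] at this
    exact this
  · refine (integrable_smoothingDeriv_kernel hρ hwm hw).mono_measure ?_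
    exact Measure.prod_mono Measure.restrict_le_self le_rfl

theorem smoothing_of_eq_zero [CompleteSpace E] (u : ℝ → E) {t : ℝ} (ht : ρ t = 0) :
    smoothing ρ u t = u t := by
  simp [smoothing, ht]

/-- A zero of the nonnegative `ρ` is a minimum, so `deriv ρ t = 0`; where `ρ` is not differentiable
this is the default value. Hence the identity holds at every zero of `ρ`, with no exceptional null
set. -/
theorem smoothingDeriv_of_eq_zero [CompleteSpace E] (hρ0 : 0 ≤ ρ) (w : ℝ → E) {t : ℝ}
    (ht : ρ t = 0) : smoothingDeriv ρ w t = w t := by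
  have : deriv ρ t = 0 := IsLocalMin.deriv_eq_zero
    (Eventually.of_forall fun s => by rw [ht]; exact hρ0 s)
  simp [smoothingDeriv, ht, this]

theorem integrable_comp_sub_mul {E : Type*} [NormedAddCommGroup E] {u : ℝ → E}
    (hu : Integrable u) (t : ℝ) {r : ℝ} (hr : r ≠ 0) : Integrable fun σ => u (t - σ * r) :=
  (hu.comp_sub_left t).comp_mul_right' hr

theorem setIntegral_comp_sub_mul (h : ℝ → ℝ) (t : ℝ) {r : ℝ} (hr : 0 < r) :
    ∫ σ in Ioo (0 : ℝ) 1, h (t - σ * r) = r⁻¹ * ∫ τ in Ioc (t - r) t, h τ := by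
  rw [← integral_Ioc_eq_integral_Ioo, ← intervalIntegral.integral_of_le zero_le_one,
    ← intervalIntegral.integral_of_le (by linarith)]
  simp_rw [mul_comm _ r]
  rw [intervalIntegral.integral_comp_sub_mul h hr.ne']
  simp

end Smoothing

/-! ### Truncation of pairs at a given height -/

section Truncation

variable {D X : Type*} [NormedAddCommGroup D] [NormedSpace ℂ D] [CompleteSpace D]
  [NormedAddCommGroup X] [NormedSpace ℂ X] [CompleteSpace X]

/-- Half the distance to the complement of the set where the maximal function exceeds `l`. -/
noncomputable def smoothingRadius (h : ℝ → ℝ) (l t : ℝ) : ℝ :=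
  1 / 2 * Metric.infDist t (maximalSet h l)ᶜ

theorem lipschitzWith_smoothingRadius (h : ℝ → ℝ) (l : ℝ) :
    LipschitzWith (1 / 2) (smoothingRadius h l) := by
  refine LipschitzWith.of_dist_le_mul fun s t => ?_
  have := (Metric.lipschitz_infDist_pt (maximalSet h l)ᶜ).dist_le_mul s t
  rw [Real.dist_eq] at this ⊢
  rw [smoothingRadius, smoothingRadius, ← mul_sub, abs_mul]
  simp only [NNReal.coe_one, one_mul] at this
  simpa using this

theorem smoothingRadius_nonneg (h : ℝ → ℝ) (l : ℝ) : 0 ≤ smoothingRadius h l :=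
  fun _ => mul_nonneg (by norm_num) Metric.infDist_nonneg

theorem smoothingRadius_eq_zero {h : ℝ → ℝ} {l t : ℝ} (ht : t ∉ maximalSet h l) :
    smoothingRadius h l t = 0 := by
  rw [smoothingRadius, Metric.infDist_zero_of_mem ht, mul_zero]

theorem compl_maximalSet_nonempty {h : ℝ → ℝ} (hh : Integrable h) (h0 : 0 ≤ h) {l : ℝ}
    (hl : 0 < l) : (maximalSet h l)ᶜ.Nonempty := by
  rw [nonempty_compl]
  intro hu
  have h1 := volume_maximalSet_le hh h0 hl
  rw [hu, Real.volume_univ, top_le_iff] at h1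
  refine ENNReal.mul_ne_top ENNReal.ofReal_ne_top ?_ h1
  exact ((setLIntegral_le_lintegral _ _).trans_lt hh.lintegral_lt_top).ne

theorem smoothingRadius_pos {h : ℝ → ℝ} (hh : Integrable h) (h0 : 0 ≤ h) {l : ℝ}
    (hl : 0 < l) {t : ℝ} (ht : t ∈ maximalSet h l) : 0 < smoothingRadius h l t := by
  have hcl : IsClosed (maximalSet h l)ᶜ := (isOpen_maximalSet h l).isClosed_compl
  have := (hcl.notMem_iff_infDist_pos (compl_maximalSet_nonempty hh h0 hl)).1
    (fun h' : t ∈ (maximalSet h l)ᶜ => h' ht)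
  unfold smoothingRadius
  linarith

/-- With `r` the radius, a nearest point `z` outside the maximal set is at distance `2 * r`, so `(t
- r, t]` lies in the ball of radius `4 * r` about `z`. There the integral of `h` is at most `8 * r *
l`, and the average divides by `r`. -/
theorem setIntegral_smoothingRadius_le {h : ℝ → ℝ} (hh : Integrable h) (h0 : 0 ≤ h) {l : ℝ}
    (hl : 0 < l) {t : ℝ} (ht : t ∈ maximalSet h l) :
    ∫ σ in Ioo (0 : ℝ) 1, h (t - σ * smoothingRadius h l t) ≤ 8 * l := by
  have hr := smoothingRadius_pos hh h0 hl ht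
  have hcl : IsClosed (maximalSet h l)ᶜ := (isOpen_maximalSet h l).isClosed_compl
  obtain ⟨z, hz, hzd⟩ := hcl.exists_infDist_eq_dist (compl_maximalSet_nonempty hh h0 hl) t
  set r := smoothingRadius h l t with hrdef
  have hrz : |t - z| = 2 * r := by
    rw [hrdef, smoothingRadius, hzd, Real.dist_eq]; ring
  rw [setIntegral_comp_sub_mul h t hr, inv_mul_le_iff₀ hr]
  calc ∫ τ in Ioc (t - r) t, h τ ≤ ∫ τ in Metric.ball z (4 * r), h τ := by
        refine setIntegral_mono_set hh.integrableOn (Eventually.of_forall h0) ?_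
        refine Eventually.of_forall fun τ hτ => ?_
        have hτ : t - r < τ ∧ τ ≤ t := hτ
        change τ ∈ Metric.ball z (4 * r)
        rw [Metric.mem_ball, Real.dist_eq, abs_lt]
        have := abs_le.1 hrz.le
        constructor <;> linarith [hτ.1, hτ.2, this.1, this.2]
    _ ≤ l * (2 * (4 * r)) := setIntegral_ball_le_of_notMem_maximalSet hz (by positivity)
        (Metric.mem_ball_self (by positivity))
    _ = r * (8 * l) := by ring

omit [CompleteSpace D] in
theorem norm_smoothing_le {u : ℝ → D} {h : ℝ → ℝ} (hh : Integrable h)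
    (huh : ∀ t, ‖u t‖ ≤ h t) {l : ℝ} (hl : 0 < l) {t : ℝ} (ht : t ∈ maximalSet h l) :
    ‖smoothing (smoothingRadius h l) u t‖ ≤ 8 * l := by
  have h0 : 0 ≤ h := fun t => (norm_nonneg _).trans (huh t)
  have hr := smoothingRadius_pos hh h0 hl ht
  refine (norm_integral_le_of_norm_le (integrable_comp_sub_mul hh t hr.ne').integrableOn
    (Eventually.of_forall fun σ => huh _)).trans (setIntegral_smoothingRadius_le hh h0 hl ht)

omit [CompleteSpace X] in
theorem norm_smoothingDeriv_le {w : ℝ → X} {h : ℝ → ℝ} (hh : Integrable h)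
    (hwh : ∀ t, ‖w t‖ ≤ h t) {l : ℝ} (hl : 0 < l) {t : ℝ} (ht : t ∈ maximalSet h l) :
    ‖smoothingDeriv (smoothingRadius h l) w t‖ ≤ 12 * l := by
  have h0 : 0 ≤ h := fun t => (norm_nonneg _).trans (hwh t)
  have hr := smoothingRadius_pos hh h0 hl ht
  have h1 : ‖smoothingDeriv (smoothingRadius h l) w t‖ ≤
      ∫ σ in Ioo (0 : ℝ) 1, 3 / 2 * h (t - σ * smoothingRadius h l t) := by
    refine norm_integral_le_of_norm_le
      ((integrable_comp_sub_mul hh t hr.ne').integrableOn.const_mul _) ?_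
    filter_upwards [ae_restrict_mem measurableSet_Ioo] with σ hσ
    have h2 := one_sub_mul_deriv_mem (lipschitzWith_smoothingRadius h l) hσ t
    rw [norm_smul, Real.norm_of_nonneg h2.1]
    exact mul_le_mul h2.2 (hwh _) (norm_nonneg _) (by norm_num)
  refine h1.trans ?_
  rw [integral_const_mul]
  linarith [setIntegral_smoothingRadius_le hh h0 hl ht]

/-- Averaging commutes with `ι`. For `ρ t ≠ 0` the map `σ ↦ t - σ * ρ t` pulls null sets back to
null sets, so the identity may be used for almost every `σ`; for `ρ t = 0` it is used at `t` itself.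
Since averages look backward, only times below `T` enter. -/
theorem ae_map_smoothing_eq {ι : D →L[ℂ] X} {T : ℝ} {u : ℝ → D} {w : ℝ → X} {ρ : ℝ → ℝ}
    (hρ : LipschitzWith (1 / 2) ρ) (hρ0 : 0 ≤ ρ) (hu : Integrable u)
    (hwm : StronglyMeasurable w) (hw : Integrable w)
    (h : ∀ᵐ t : ℝ, t < T → ι (u t) = ∫ τ in Iic t, w τ) :
    ∀ᵐ t : ℝ, t < T →
      ι (smoothing ρ u t) = ∫ τ in Iic t, smoothingDeriv ρ w τ := by
  filter_upwards [h] with t ht htT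
  rw [setIntegral_Iic_smoothingDeriv hρ hwm hw]
  rcases (hρ0 t).eq_or_lt with h1 | h1
  · have h1 : ρ t = 0 := h1.symm
    rw [smoothing_of_eq_zero u h1, ht htT]
    simp [h1]
  · rw [smoothing, ← ContinuousLinearMap.integral_comp_comm ι
      (integrable_comp_sub_mul hu t h1.ne').integrableOn]
    refine integral_congr_ae ?_
    have hq : Measure.QuasiMeasurePreserving (fun σ => t - σ * ρ t) volume volume := by
      refine ⟨by fun_prop, ?_⟩
      have h2 : (fun σ => t - σ * ρ t) = (fun x => t - x) ∘ (fun σ => σ * ρ t) := rfl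
      rw [h2, ← Measure.map_map (by fun_prop) (by fun_prop), Real.map_volume_mul_right h1.ne',
        Measure.map_smul, (Measure.measurePreserving_sub_left volume t).map_eq]
      exact Measure.smul_absolutelyContinuous
    filter_upwards [ae_restrict_of_ae (hq.ae h), ae_restrict_mem measurableSet_Ioo] with σ hσ hσ2
    exact hσ ((sub_le_self t (mul_nonneg hσ2.1.le h1.le)).trans_lt htT)

/-- Truncation of a pair `(u, u')` at height `l`: outside a set `O` the pair is unchanged, inside
`O` it is bounded by a multiple of `l`. -/
theorem exists_truncation {ι : D →L[ℂ] X} {T : ℝ} {u : ℝ → D} {w : ℝ → X}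
    (hu : Integrable u (timeMeasure T)) (hw : Integrable w (timeMeasure T))
    (h : ∀ᵐ t ∂(timeMeasure T), ι (u t) = ∫ τ in 0..t, w τ) {l : ℝ} (hl : 0 < l) :
    ∃ (O : Set ℝ) (v : ℝ → D) (z : ℝ → X), MeasurableSet O ∧
      AEStronglyMeasurable v (timeMeasure T) ∧ AEStronglyMeasurable z (timeMeasure T) ∧
      (∀ᵐ t ∂(timeMeasure T), ι (v t) = ∫ τ in 0..t, z τ) ∧
      (∀ᵐ t ∂(timeMeasure T), t ∉ O → v t = u t ∧ z t = w t ∧ ‖u t‖ + ‖w t‖ ≤ l) ∧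
      (∀ᵐ t ∂(timeMeasure T), t ∈ O → ‖v t‖ ≤ 8 * l ∧ ‖z t‖ ≤ 12 * l) ∧
      timeMeasure T O ≤ ENNReal.ofReal (10 / l) *
        ∫⁻ t in {t | l / 2 < ‖u t‖ + ‖w t‖}, ENNReal.ofReal (‖u t‖ + ‖w t‖) ∂(timeMeasure T) := by
  -- Strongly measurable representatives, extended by zero to the line, so that maximal function and
  -- averages are defined without boundary effects.
  set u₀ : ℝ → D := (Ioo 0 T).indicator (hu.1.mk u) with hu₀
  set w₀ : ℝ → X := (Ioo 0 T).indicator (hw.1.mk w) with hw₀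
  have hu₀m : StronglyMeasurable u₀ := hu.1.stronglyMeasurable_mk.indicator measurableSet_Ioo
  have hw₀m : StronglyMeasurable w₀ := hw.1.stronglyMeasurable_mk.indicator measurableSet_Ioo
  have hu₀i : Integrable u₀ :=
    (integrable_indicator_iff measurableSet_Ioo).2 (hu.congr hu.1.ae_eq_mk)
  have hw₀i : Integrable w₀ :=
    (integrable_indicator_iff measurableSet_Ioo).2 (hw.congr hw.1.ae_eq_mk)
  have hu₀e : u =ᵐ[timeMeasure T] u₀ := by
    filter_upwards [hu.1.ae_eq_mk, ae_timeMeasure_mem T] with t h1 h2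
    rw [hu₀, indicator_of_mem h2, h1]
  have hw₀e : w =ᵐ[timeMeasure T] w₀ := by
    filter_upwards [hw.1.ae_eq_mk, ae_timeMeasure_mem T] with t h1 h2
    rw [hw₀, indicator_of_mem h2, h1]
  set g : ℝ → ℝ := fun t => ‖u₀ t‖ + ‖w₀ t‖ with hg
  have hgi : Integrable g := hu₀i.norm.add hw₀i.norm
  have hg0 : 0 ≤ g := fun t => add_nonneg (norm_nonneg _) (norm_nonneg _)
  set ρ := smoothingRadius g l with hρ
  have hρL : LipschitzWith (1 / 2) ρ := lipschitzWith_smoothingRadius g l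
  have hρ0 : 0 ≤ ρ := smoothingRadius_nonneg g l
  have hw₀neg : ∀ t ≤ 0, w₀ t = 0 := fun t ht =>
    indicator_of_notMem (fun h' => absurd h'.1 (not_lt.2 ht)) _
  have hu₀neg : ∀ t ≤ 0, u₀ t = 0 := fun t ht =>
    indicator_of_notMem (fun h' => absurd h'.1 (not_lt.2 ht)) _
  have hIic : ∀ f : ℝ → X, Integrable f → (∀ t ≤ 0, f t = 0) → ∀ t, 0 < t →
      ∫ τ in Iic t, f τ = ∫ τ in 0..t, f τ := by
    intro f hf hf0 t ht
    rw [← intervalIntegral.integral_Iic_sub_Iic hf.integrableOn hf.integrableOn,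
      setIntegral_eq_zero_of_forall_eq_zero (t := Iic 0) hf0, sub_zero]
  have hprim : ∀ᵐ t : ℝ, t < T → ι (u₀ t) = ∫ τ in Iic t, w₀ τ := by
    have h1 : ∀ᵐ t ∂(timeMeasure T), ι (u₀ t) = ∫ τ in Iic t, w₀ τ := by
      filter_upwards [h, hu₀e, ae_timeMeasure_mem T] with t h1 h2 h3
      rw [hIic w₀ hw₀i hw₀neg t h3.1, ← h2, h1, intervalIntegral_congr_timeMeasure h3 hw₀e]
    rw [timeMeasure, ae_restrict_iff' measurableSet_Ioo] at h1
    filter_upwards [h1] with t h2 h3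
    rcases le_or_gt t 0 with ht | ht
    · rw [hu₀neg t ht, map_zero,
        setIntegral_eq_zero_of_forall_eq_zero (t := Iic t)
          fun τ hτ => hw₀neg τ (le_trans (mem_Iic.1 hτ) ht)]
    · exact h2 ⟨ht, h3⟩
  -- Backward averages of a function vanishing on the negative axis vanish there too; this preserves
  -- the zero initial value.
  have hzneg : ∀ t ≤ 0, smoothingDeriv ρ w₀ t = 0 := by
    intro t ht
    refine setIntegral_eq_zero_of_forall_eq_zero fun σ hσ => ?_
    rw [hw₀neg, smul_zero]
    linarith [mul_nonneg hσ.1.le (hρ0 t)]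
  refine ⟨maximalSet g l, smoothing ρ u₀, smoothingDeriv ρ w₀,
    (isOpen_maximalSet g l).measurableSet,
    (stronglyMeasurable_smoothing hρL hu₀m).aestronglyMeasurable,
    (stronglyMeasurable_smoothingDeriv hρL hw₀m).aestronglyMeasurable, ?_, ?_, ?_, ?_⟩
  · filter_upwards [ae_restrict_of_ae (ae_map_smoothing_eq hρL hρ0 hu₀i hw₀m hw₀i hprim),
      ae_timeMeasure_mem T] with t h1 h2
    rw [h1 h2.2, hIic _ (integrable_smoothingDeriv hρL hw₀m hw₀i) hzneg t h2.1]
  · filter_upwards [ae_restrict_of_ae (ae_le_of_notMem_maximalSet hgi l), hu₀e, hw₀e]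
      with t h1 h2 h3 h4
    have h5 : ρ t = 0 := smoothingRadius_eq_zero h4
    rw [smoothing_of_eq_zero u₀ h5, smoothingDeriv_of_eq_zero hρ0 w₀ h5, h2, h3]
    exact ⟨rfl, rfl, h1 h4⟩
  · exact Eventually.of_forall fun t ht =>
      ⟨norm_smoothing_le hgi (fun _ => le_add_of_nonneg_right (norm_nonneg _)) hl ht,
        norm_smoothingDeriv_le hgi (fun _ => le_add_of_nonneg_left (norm_nonneg _)) hl ht⟩
  · refine (Measure.restrict_le_self _).trans ((volume_maximalSet_le hgi hg0 hl).trans_eq ?_)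
    congr 1
    have hsub : {t | l / 2 < g t} ⊆ Ioo 0 T := by
      intro t ht
      by_contra hn
      have ht : l / 2 < ‖u₀ t‖ + ‖w₀ t‖ := ht
      rw [hu₀, hw₀, indicator_of_notMem hn, indicator_of_notMem hn, norm_zero, norm_zero] at ht
      linarith
    have hgm : Measurable g := hu₀m.norm.measurable.add hw₀m.norm.measurable
    have hge : ∀ᵐ t ∂(timeMeasure T), ‖u t‖ + ‖w t‖ = g t := by
      filter_upwards [hu₀e, hw₀e] with t h2 h3
      rw [h2, h3]
    have hset : {t | l / 2 < ‖u t‖ + ‖w t‖} =ᵐ[timeMeasure T] {t | l / 2 < g t} := by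
      filter_upwards [hge] with t ht
      change (l / 2 < ‖u t‖ + ‖w t‖) = (l / 2 < g t)
      rw [ht]
    rw [setLIntegral_congr hset, timeMeasure, Measure.restrict_restrict_of_subset hsub]
    have : ∀ᵐ t ∂(volume.restrict {t | l / 2 < g t}), ‖u t‖ + ‖w t‖ = g t :=
      ae_restrict_of_ae_restrict_of_subset hsub hge
    refine lintegral_congr_ae ?_
    filter_upwards [this] with t ht
    rw [ht]

end Truncation

/-! ### From level set inequalities to neighbouring exponents -/

section LevelSets

variable {α : Type*} [MeasurableSpace α] {μ : Measure α}

theorem ofReal_rpow_mul_ofReal_rpow {x a b : ℝ} (hx : 0 ≤ x) (hab : a + b ≠ 0) :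
    ENNReal.ofReal (x ^ a) * ENNReal.ofReal (x ^ b) = ENNReal.ofReal (x ^ (a + b)) := by
  rw [← ENNReal.ofReal_mul (Real.rpow_nonneg hx _), ← Real.rpow_add' hx hab]

/-- Weighted layer cake formula. -/
theorem lintegral_mul_rpow_eq {g f : α → ℝ} (hg : Measurable g) (hf : Measurable f) (hf0 : 0 ≤ f)
    {q : ℝ} (hq : 0 < q) :
    ∫⁻ a, ENNReal.ofReal (g a) * ENNReal.ofReal (f a ^ q) ∂μ =
      ENNReal.ofReal q * ∫⁻ l in Ioi (0 : ℝ),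
        (∫⁻ a in {a | l < f a}, ENNReal.ofReal (g a) ∂μ) * ENNReal.ofReal (l ^ (q - 1)) := by
  have h := lintegral_rpow_eq_lintegral_meas_lt_mul
    (μ.withDensity fun a => ENNReal.ofReal (g a)) (Eventually.of_forall hf0) hf.aemeasurable hq
  rw [lintegral_withDensity_eq_lintegral_mul _ hg.ennreal_ofReal
    (hf.pow_const q).ennreal_ofReal] at h
  simp only [Pi.mul_apply] at h
  rw [h]
  congr 1
  refine lintegral_congr fun l => ?_
  rw [withDensity_apply _ (measurableSet_lt measurable_const hf)]

theorem le_mul_two_of_le_add_half {a b : ℝ≥0∞} {c : ℝ≥0∞} (hc : c ≤ 2⁻¹) (ha : a ≠ ⊤)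
    (h : a ≤ b + c * a) : a ≤ 2 * b := by
  have h1 : a ≤ b + 2⁻¹ * a := h.trans (by gcongr)
  have h2 : 2⁻¹ * a ≠ ⊤ := ENNReal.mul_ne_top (by simp) ha
  have h3 : 2⁻¹ * a + 2⁻¹ * a ≤ b + 2⁻¹ * a := by
    rwa [← add_mul, ENNReal.inv_two_add_inv_two, one_mul]
  have h4 := (ENNReal.add_le_add_iff_right h2).1 h3
  calc a = 2 * (2⁻¹ * a) := by
        rw [← mul_assoc, ENNReal.mul_inv_cancel (by simp) (by simp), one_mul]
    _ ≤ 2 * b := by gcongr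

/-- Gehring's lemma for level set inequalities, for the truncated function. -/
theorem lintegral_mul_min_rpow_le {h k : α → ℝ} (hm : Measurable h) (km : Measurable k)
    (h0 : 0 ≤ h) (k0 : 0 ≤ k) {r s : ℝ} (hr : 1 < r) (hrs : r < s) {C : ℝ} (hC : 0 ≤ C)
    (hfin : ∫⁻ a, ENNReal.ofReal (h a ^ r) ∂μ ≠ ⊤)
    (H : ∀ l : ℝ, 0 < l → ∫⁻ a in {a | l < h a}, ENNReal.ofReal (h a ^ r) ∂μ ≤
      ENNReal.ofReal C * ((∫⁻ a in {a | l < k a}, ENNReal.ofReal (k a ^ r) ∂μ) +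
        ENNReal.ofReal (l ^ (r - 1)) * ∫⁻ a in {a | l / 2 < h a}, ENNReal.ofReal (h a) ∂μ))
    (hδ : C * (s - r) * (2 ^ (s - 1) / (s - 1)) ≤ 1 / 2) {L : ℝ} (hL : 0 < L) :
    ∫⁻ a, ENNReal.ofReal (h a ^ r) * ENNReal.ofReal (min (h a) L ^ (s - r)) ∂μ ≤
      2 * (ENNReal.ofReal C * ∫⁻ a, ENNReal.ofReal (k a ^ s) ∂μ) := by
  set I := ∫⁻ a, ENNReal.ofReal (h a ^ r) * ENNReal.ofReal (min (h a) L ^ (s - r)) ∂μ with hI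
  have hq : 0 < s - r := sub_pos.2 hrs
  have hmin0 : ∀ a, 0 ≤ min (h a) L := fun a => le_min (h0 a) hL.le
  -- The cut-off at `L` bounds the weight by `L ^ (s - r)`. Finiteness is indispensable for
  -- absorbing a multiple of `I` at the end.
  have hIfin : I ≠ ⊤ := by
    have : I ≤ (∫⁻ a, ENNReal.ofReal (h a ^ r) ∂μ) * ENNReal.ofReal (L ^ (s - r)) := by
      rw [← lintegral_mul_const _ (hm.pow_const r).ennreal_ofReal]
      refine lintegral_mono fun a => ?_
      gcongr
      · exact hmin0 a
      · exact min_le_right _ _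
    exact ne_top_of_le_ne_top (ENNReal.mul_ne_top hfin ENNReal.ofReal_ne_top) this
  have hK : ∫⁻ a, ENNReal.ofReal (k a ^ s) ∂μ = ENNReal.ofReal (s - r) *
      ∫⁻ l in Ioi (0 : ℝ), (∫⁻ a in {a | l < k a}, ENNReal.ofReal (k a ^ r) ∂μ) *
        ENNReal.ofReal (l ^ (s - r - 1)) := by
    rw [← lintegral_mul_rpow_eq (km.pow_const r) km k0 hq]
    refine lintegral_congr fun a => ?_
    rw [ofReal_rpow_mul_ofReal_rpow (k0 a) (by linarith)]
    congr 2; ring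
  -- The level `l / 2` costs the factor `2 ^ (s - 1)`. The cut-off `min (2 * h a) L` is chosen so
  -- that its level sets are `{l / 2 < h}` for `l < L`.
  have hJ : ENNReal.ofReal (s - 1) * ∫⁻ l in Ioi (0 : ℝ),
      (∫⁻ a in {a | l < min (2 * h a) L}, ENNReal.ofReal (h a) ∂μ) * ENNReal.ofReal (l ^ (s - 1 - 1))
      ≤ ENNReal.ofReal (2 ^ (s - 1)) * I := by
    rw [← lintegral_mul_rpow_eq hm ((hm.const_mul 2).min measurable_const)
      (fun a => le_min (mul_nonneg two_pos.le (h0 a)) hL.le) (by linarith), hI,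
      ← lintegral_const_mul' _ _ ENNReal.ofReal_ne_top]
    refine lintegral_mono fun a => ?_
    rw [← ENNReal.ofReal_mul (h0 a), ← ENNReal.ofReal_mul (Real.rpow_nonneg (h0 a) _),
      ← ENNReal.ofReal_mul (by positivity)]
    refine ENNReal.ofReal_le_ofReal ?_
    have hm0 := hmin0 a
    rcases (h0 a).eq_or_lt with hz | hpos
    · rw [← hz]
      simp only [Pi.zero_apply, zero_mul]
      positivity
    replace hpos : 0 < h a := hpos
    have hmpos : 0 < min (h a) L := lt_min hpos hL
    calc h a * min (2 * h a) L ^ (s - 1)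
        ≤ h a * (2 * min (h a) L) ^ (s - 1) := by
          refine mul_le_mul_of_nonneg_left (Real.rpow_le_rpow
            (le_min (mul_nonneg two_pos.le hpos.le) hL.le) ?_ (by linarith)) hpos.le
          rw [mul_min_of_nonneg _ _ two_pos.le]
          exact min_le_min le_rfl (by linarith)
      _ = 2 ^ (s - 1) * (h a * (min (h a) L ^ (r - 1) * min (h a) L ^ (s - r))) := by
          rw [Real.mul_rpow two_pos.le hm0, ← Real.rpow_add hmpos]
          rw [show r - 1 + (s - r) = s - 1 by ring]
          ring
      _ ≤ 2 ^ (s - 1) * (h a * (h a ^ (r - 1) * min (h a) L ^ (s - r))) := by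
          have : min (h a) L ^ (r - 1) ≤ h a ^ (r - 1) :=
            Real.rpow_le_rpow hm0 (min_le_left _ _) (by linarith)
          gcongr
      _ = 2 ^ (s - 1) * (h a ^ r * min (h a) L ^ (s - r)) := by
          have : h a ^ r = h a * h a ^ (r - 1) := by
            rw [← Real.rpow_one_add' hpos.le (by linarith)]; congr 1; ring
          rw [this]; ring
  have hmain : I ≤ ENNReal.ofReal C * (∫⁻ a, ENNReal.ofReal (k a ^ s) ∂μ) +
      ENNReal.ofReal (C * (s - r) * (2 ^ (s - 1) / (s - 1))) * I := by
    have hIl : I = ENNReal.ofReal (s - r) * ∫⁻ l in Ioi (0 : ℝ),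
        (∫⁻ a in {a | l < min (h a) L}, ENNReal.ofReal (h a ^ r) ∂μ) *
          ENNReal.ofReal (l ^ (s - r - 1)) :=
      lintegral_mul_rpow_eq (hm.pow_const r) (hm.min measurable_const) hmin0 hq
    have hpt : ∀ l ∈ Ioi (0 : ℝ), (∫⁻ a in {a | l < min (h a) L}, ENNReal.ofReal (h a ^ r) ∂μ) *
          ENNReal.ofReal (l ^ (s - r - 1)) ≤
        ENNReal.ofReal C * ((∫⁻ a in {a | l < k a}, ENNReal.ofReal (k a ^ r) ∂μ) *
            ENNReal.ofReal (l ^ (s - r - 1))) +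
          ENNReal.ofReal C * ((∫⁻ a in {a | l < min (2 * h a) L}, ENNReal.ofReal (h a) ∂μ) *
            ENNReal.ofReal (l ^ (s - 1 - 1))) := by
      intro l hl
      have hl : 0 < l := hl
      -- Levels above `L` are empty on the left side, so `H` is only needed below `L`, where the
      -- cut-offs are invisible.
      rcases le_or_gt L l with hLl | hLl
      · have : {a | l < min (h a) L} = ∅ :=
          eq_empty_of_forall_notMem fun a ha => absurd (lt_min_iff.1 ha).2 (not_lt.2 hLl)
        rw [this]; simp
      · have e1 : {a | l < min (h a) L} = {a | l < h a} := by
          ext a; simp [hLl]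
        have e2 : {a | l < min (2 * h a) L} = {a | l / 2 < h a} := by
          ext a
          simp only [mem_ofPred_eq, lt_min_iff, hLl, and_true]
          constructor <;> intro <;> linarith
        rw [e1, e2]
        have e3 : ENNReal.ofReal (l ^ (s - 1 - 1)) =
            ENNReal.ofReal (l ^ (r - 1)) * ENNReal.ofReal (l ^ (s - r - 1)) := by
          rw [← ENNReal.ofReal_mul (by positivity), ← Real.rpow_add hl]
          congr 2; ring
        calc _ ≤ _ := mul_le_mul_left (H l hl) _
          _ = _ := by rw [e3]; ring
    have hcut : ENNReal.ofReal (C * (s - r) * (2 ^ (s - 1) / (s - 1))) * I =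
        ENNReal.ofReal C * (ENNReal.ofReal (s - r) * (ENNReal.ofReal (1 / (s - 1)) *
          (ENNReal.ofReal (2 ^ (s - 1)) * I))) := by
      have hs1 : 0 < s - 1 := by linarith
      rw [show C * (s - r) * (2 ^ (s - 1) / (s - 1)) =
        C * ((s - r) * ((1 / (s - 1)) * 2 ^ (s - 1))) by ring, ENNReal.ofReal_mul hC,
        ENNReal.ofReal_mul hq.le, ENNReal.ofReal_mul (by positivity)]
      ring
    calc I = _ := hIl
      _ ≤ ENNReal.ofReal (s - r) * ∫⁻ l in Ioi (0 : ℝ),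
          (ENNReal.ofReal C * ((∫⁻ a in {a | l < k a}, ENNReal.ofReal (k a ^ r) ∂μ) *
            ENNReal.ofReal (l ^ (s - r - 1))) +
          ENNReal.ofReal C * ((∫⁻ a in {a | l < min (2 * h a) L}, ENNReal.ofReal (h a) ∂μ) *
            ENNReal.ofReal (l ^ (s - 1 - 1)))) := by
          exact mul_le_mul' le_rfl (setLIntegral_mono' measurableSet_Ioi hpt)
      _ = ENNReal.ofReal C * (∫⁻ a, ENNReal.ofReal (k a ^ s) ∂μ) +
          ENNReal.ofReal C * (ENNReal.ofReal (s - r) * ∫⁻ l in Ioi (0 : ℝ),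
            (∫⁻ a in {a | l < min (2 * h a) L}, ENNReal.ofReal (h a) ∂μ) *
              ENNReal.ofReal (l ^ (s - 1 - 1))) := by
          rw [lintegral_add_left, lintegral_const_mul' _ _ ENNReal.ofReal_ne_top,
            lintegral_const_mul' _ _ ENNReal.ofReal_ne_top, hK]
          · ring
          · refine Measurable.const_mul (Measurable.mul ?_ (by fun_prop)) _
            refine Antitone.measurable fun l l' hll' => ?_
            exact lintegral_mono_set fun a (ha : l' < k a) => hll'.trans_lt ha
      _ ≤ _ := by
          rw [hcut]
          gcongr
          have hs1 : 0 < s - 1 := by linarith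
          calc _ = ENNReal.ofReal (1 / (s - 1)) * (ENNReal.ofReal (s - 1) * ∫⁻ l in Ioi (0 : ℝ),
                (∫⁻ a in {a | l < min (2 * h a) L}, ENNReal.ofReal (h a) ∂μ) *
                ENNReal.ofReal (l ^ (s - 1 - 1))) := by
                rw [← mul_assoc, ← ENNReal.ofReal_mul (by positivity), one_div_mul_cancel hs1.ne',
                  ENNReal.ofReal_one, one_mul]
            _ ≤ _ := by gcongr
  refine le_mul_two_of_le_add_half ?_ hIfin hmain
  rw [← ENNReal.ofReal_ofNat 2, ← ENNReal.ofReal_inv_of_pos two_pos]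
  exact ENNReal.ofReal_le_ofReal (by linarith)

/-- Gehring's lemma: a level set inequality at the exponent `r` gives integrability at exponents
`s > r` close to `r`. -/
theorem lintegral_rpow_le_of_level_gt {h k : α → ℝ} (hm : Measurable h) (km : Measurable k)
    (h0 : 0 ≤ h) (k0 : 0 ≤ k) {r s : ℝ} (hr : 1 < r) (hrs : r < s) {C : ℝ} (hC : 0 ≤ C)
    (hfin : ∫⁻ a, ENNReal.ofReal (h a ^ r) ∂μ ≠ ⊤)
    (H : ∀ l : ℝ, 0 < l → ∫⁻ a in {a | l < h a}, ENNReal.ofReal (h a ^ r) ∂μ ≤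
      ENNReal.ofReal C * ((∫⁻ a in {a | l < k a}, ENNReal.ofReal (k a ^ r) ∂μ) +
        ENNReal.ofReal (l ^ (r - 1)) * ∫⁻ a in {a | l / 2 < h a}, ENNReal.ofReal (h a) ∂μ))
    (hδ : C * (s - r) * (2 ^ (s - 1) / (s - 1)) ≤ 1 / 2) :
    ∫⁻ a, ENNReal.ofReal (h a ^ s) ∂μ ≤
      2 * (ENNReal.ofReal C * ∫⁻ a, ENNReal.ofReal (k a ^ s) ∂μ) := by
  -- The bound for the truncated integrals does not depend on the height, so monotone convergence
  -- removes the cut-off.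
  have hlim : Tendsto (fun n : ℕ => ∫⁻ a, ENNReal.ofReal (h a ^ r) *
      ENNReal.ofReal (min (h a) ((n : ℝ) + 1) ^ (s - r)) ∂μ) atTop
      (𝓝 (∫⁻ a, ENNReal.ofReal (h a ^ s) ∂μ)) := by
    refine lintegral_tendsto_of_tendsto_of_monotone (fun n => ?_) ?_ ?_
    · exact ((hm.pow_const r).ennreal_ofReal.mul
        ((hm.min measurable_const).pow_const _).ennreal_ofReal).aemeasurable
    · refine Eventually.of_forall fun a n m hnm => ?_
      have : (n : ℝ) ≤ m := by exact_mod_cast hnm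
      simp only
      gcongr
      · exact le_min (h0 a) (by positivity)
    · refine Eventually.of_forall fun a => tendsto_const_nhds.congr' ?_
      obtain ⟨N, hN⟩ := exists_nat_ge (h a)
      filter_upwards [eventually_ge_atTop N] with n hn
      have : (N : ℝ) ≤ n := by exact_mod_cast hn
      rw [min_eq_left (by linarith), ofReal_rpow_mul_ofReal_rpow (h0 a) (by linarith)]
      congr 2; ring
  exact le_of_tendsto' hlim fun n =>
    lintegral_mul_min_rpow_le hm km h0 k0 hr hrs hC hfin H hδ (by positivity)

theorem lintegral_Ioi_rpow_indicator {x q : ℝ} (hx : 0 < x) (hq : 0 < q) :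
    ∫⁻ l in Ioi (0 : ℝ), (Ici x).indicator (fun l => ENNReal.ofReal (l ^ (-q - 1))) l =
      ENNReal.ofReal (1 / q) * ENNReal.ofReal (x ^ (-q)) := by
  have hsub : Ici x ∩ Ioi 0 = Ici x := inter_eq_left.2 fun l hl => hx.trans_le hl
  rw [setLIntegral_indicator measurableSet_Ici, hsub, ← restrict_Ioi_eq_restrict_Ici,
    ← ofReal_integral_eq_lintegral_ofReal, integral_Ioi_rpow_of_lt (by linarith) hx,
    ← ENNReal.ofReal_mul (by positivity)]
  · congr 1
    rw [show -q - 1 + 1 = -q by ring]; field_simp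
  · exact integrableOn_Ioi_rpow_of_lt (by linarith) hx
  · filter_upwards [ae_restrict_mem measurableSet_Ioi] with l hl
    exact Real.rpow_nonneg (hx.trans hl).le _

/-- Layer cake formula over sublevel sets. -/
theorem lintegral_sublevel_mul_rpow_eq [SFinite μ] {f : α → ℝ} (hf : Measurable f) (hf0 : 0 ≤ f)
    {r s : ℝ} (hs : 0 < s) (hsr : s < r) :
    ∫⁻ l in Ioi (0 : ℝ), (∫⁻ a in {a | f a ≤ l}, ENNReal.ofReal (f a ^ r) ∂μ) *
        ENNReal.ofReal (l ^ (s - r - 1)) =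
      ENNReal.ofReal (1 / (r - s)) * ∫⁻ a, ENNReal.ofReal (f a ^ s) ∂μ := by
  have h1 : ∀ l : ℝ, (∫⁻ a in {a | f a ≤ l}, ENNReal.ofReal (f a ^ r) ∂μ) *
      ENNReal.ofReal (l ^ (s - r - 1)) = ∫⁻ a, ENNReal.ofReal (f a ^ r) *
        (Ici (f a)).indicator (fun l => ENNReal.ofReal (l ^ (-(r - s) - 1))) l ∂μ := by
    intro l
    rw [← lintegral_mul_const' _ _ ENNReal.ofReal_ne_top,
      ← lintegral_indicator (measurableSet_le hf measurable_const)]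
    refine lintegral_congr fun a => ?_
    by_cases ha : f a ≤ l
    · rw [indicator_of_mem (show a ∈ {a | f a ≤ l} from ha),
        indicator_of_mem (show l ∈ Ici (f a) from ha), neg_sub]
    · rw [indicator_of_notMem (show a ∉ {a | f a ≤ l} from ha),
        indicator_of_notMem (show l ∉ Ici (f a) from ha), mul_zero]
  simp_rw [h1]
  rw [lintegral_lintegral_swap, ← lintegral_const_mul' _ _ ENNReal.ofReal_ne_top]
  · refine lintegral_congr fun a => ?_
    rw [lintegral_const_mul' _ _ ENNReal.ofReal_ne_top]
    rcases (hf0 a).eq_or_lt with hz | hpos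
    · have hz : f a = 0 := hz.symm
      rw [hz, Real.zero_rpow (by linarith), Real.zero_rpow hs.ne']
      simp
    · replace hpos : 0 < f a := hpos
      rw [lintegral_Ioi_rpow_indicator hpos (by linarith), mul_left_comm,
        ofReal_rpow_mul_ofReal_rpow hpos.le (by linarith)]
      congr 3; ring
  · refine Measurable.aemeasurable ?_
    refine Measurable.mul (((hf.comp measurable_snd).pow_const r).ennreal_ofReal) ?_
    have : (fun p : ℝ × α => (Ici (f p.2)).indicator
        (fun l => ENNReal.ofReal (l ^ (-(r - s) - 1))) p.1) =
        {p : ℝ × α | f p.2 ≤ p.1}.indicator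
          (fun p => ENNReal.ofReal (p.1 ^ (-(r - s) - 1))) := by
      ext p; simp [indicator]
    rw [this]
    exact ((measurable_fst.pow_const _).ennreal_ofReal).indicator
      (measurableSet_le (hf.comp measurable_snd) measurable_fst)

/-- A level set inequality at the exponent `r` gives an estimate at exponents `s < r` close
to `r`. -/
theorem lintegral_rpow_le_of_level_le [SFinite μ] {h k : α → ℝ} (hm : Measurable h)
    (km : Measurable k)
    (h0 : 0 ≤ h) (k0 : 0 ≤ k) {r s : ℝ} (hs : 1 < s) (hsr : s < r) {C : ℝ} (hC : 0 ≤ C)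
    (hfin : ∫⁻ a, ENNReal.ofReal (h a ^ s) ∂μ ≠ ⊤)
    (H : ∀ l : ℝ, 0 < l → ∫⁻ a in {a | h a ≤ l}, ENNReal.ofReal (h a ^ r) ∂μ ≤
      ENNReal.ofReal C * ((∫⁻ a in {a | k a ≤ l}, ENNReal.ofReal (k a ^ r) ∂μ) +
        ENNReal.ofReal (l ^ r) * μ {a | l < k a} +
        ENNReal.ofReal (l ^ (r - 1)) * ∫⁻ a in {a | l / 2 < h a}, ENNReal.ofReal (h a) ∂μ))
    (hδ : C * (r - s) * (2 ^ (s - 1) / (s - 1)) ≤ 1 / 2) :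
    ∫⁻ a, ENNReal.ofReal (h a ^ s) ∂μ ≤
      2 * (ENNReal.ofReal (C * r) * ∫⁻ a, ENNReal.ofReal (k a ^ s) ∂μ) := by
  have hq : 0 < r - s := sub_pos.2 hsr
  have hs0 : 0 < s := by linarith
  have hs1 : 0 < s - 1 := by linarith
  have hinv : ∀ x : ℝ, 0 < x → ∀ b : ℝ≥0∞,
      b = ENNReal.ofReal (1 / x) * (ENNReal.ofReal x * b) := by
    intro x hx b
    rw [← mul_assoc, ← ENNReal.ofReal_mul (by positivity), one_div_mul_cancel hx.ne',
      ENNReal.ofReal_one, one_mul]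
  set I := ∫⁻ a, ENNReal.ofReal (h a ^ s) ∂μ with hI
  set K := ∫⁻ a, ENNReal.ofReal (k a ^ s) ∂μ with hK
  have hK2 : ∫⁻ l in Ioi (0 : ℝ), μ {a | l < k a} * ENNReal.ofReal (l ^ (s - 1)) =
      ENNReal.ofReal (1 / s) * K := by
    rw [hK, lintegral_rpow_eq_lintegral_meas_lt_mul μ (Eventually.of_forall k0) km.aemeasurable hs0]
    exact hinv s hs0 _
  have hJ : ∫⁻ l in Ioi (0 : ℝ), (∫⁻ a in {a | l / 2 < h a}, ENNReal.ofReal (h a) ∂μ) *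
      ENNReal.ofReal (l ^ (s - 1 - 1)) = ENNReal.ofReal (2 ^ (s - 1) / (s - 1)) * I := by
    have h1 := lintegral_mul_rpow_eq (μ := μ) hm (hm.const_mul 2)
      (fun a => mul_nonneg two_pos.le (h0 a)) hs1
    have h2 : ∫⁻ a, ENNReal.ofReal (h a) * ENNReal.ofReal ((2 * h a) ^ (s - 1)) ∂μ =
        ENNReal.ofReal (2 ^ (s - 1)) * I := by
      rw [hI, ← lintegral_const_mul' _ _ ENNReal.ofReal_ne_top]
      refine lintegral_congr fun a => ?_
      rw [Real.mul_rpow two_pos.le (h0 a), ENNReal.ofReal_mul (by positivity), mul_left_comm]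
      congr 1
      have := ofReal_rpow_mul_ofReal_rpow (h0 a) (a := 1) (b := s - 1) (by linarith)
      rw [Real.rpow_one] at this
      rw [this]
      congr 2; ring
    have h3 : ∀ l : ℝ, {a | l < 2 * h a} = {a | l / 2 < h a} := by
      intro l; ext a
      simp only [mem_ofPred_eq]
      constructor <;> intro <;> linarith
    simp_rw [h3] at h1
    rw [hinv (s - 1) hs1 (∫⁻ l in Ioi (0 : ℝ), _), ← h1, h2, ← mul_assoc,
      ← ENNReal.ofReal_mul (by positivity)]
    congr 2; ring
  have hmain : ENNReal.ofReal (1 / (r - s)) * I ≤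
      ENNReal.ofReal C * (ENNReal.ofReal (1 / (r - s)) * K + ENNReal.ofReal (1 / s) * K +
        ENNReal.ofReal (2 ^ (s - 1) / (s - 1)) * I) := by
    rw [hI, ← lintegral_sublevel_mul_rpow_eq hm h0 hs0 hsr, ← hI, ← hJ, ← hK2, hK,
      ← lintegral_sublevel_mul_rpow_eq km k0 hs0 hsr]
    have hmeas1 : Measurable fun l : ℝ =>
        (∫⁻ a in {a | k a ≤ l}, ENNReal.ofReal (k a ^ r) ∂μ) * ENNReal.ofReal (l ^ (s - r - 1)) :=
      (Monotone.measurable fun l l' hll' =>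
        lintegral_mono_set fun a (ha : k a ≤ l) => ha.trans hll').mul (by fun_prop)
    have hmeas2 : Measurable fun l : ℝ => μ {a | l < k a} * ENNReal.ofReal (l ^ (s - 1)) :=
      (Antitone.measurable fun l l' hll' =>
        measure_mono fun a (ha : l' < k a) => hll'.trans_lt ha).mul (by fun_prop)
    have hmeas3 : Measurable fun l : ℝ =>
        (∫⁻ a in {a | k a ≤ l}, ENNReal.ofReal (k a ^ r) ∂μ) * ENNReal.ofReal (l ^ (s - r - 1)) +
          μ {a | l < k a} * ENNReal.ofReal (l ^ (s - 1)) := hmeas1.add hmeas2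
    rw [← lintegral_add_left hmeas1, ← lintegral_add_left hmeas3,
      ← lintegral_const_mul' _ _ ENNReal.ofReal_ne_top]
    refine setLIntegral_mono' measurableSet_Ioi fun l hl => ?_
    have hl : 0 < l := hl
    have e3 : ENNReal.ofReal (l ^ (s - 1 - 1)) =
        ENNReal.ofReal (l ^ (r - 1)) * ENNReal.ofReal (l ^ (s - r - 1)) := by
      rw [← ENNReal.ofReal_mul (by positivity), ← Real.rpow_add hl]
      congr 2; ring
    have e4 : ENNReal.ofReal (l ^ (s - 1)) =
        ENNReal.ofReal (l ^ r) * ENNReal.ofReal (l ^ (s - r - 1)) := by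
      rw [← ENNReal.ofReal_mul (by positivity), ← Real.rpow_add hl]
      congr 2; ring
    calc _ ≤ _ := mul_le_mul_left (H l hl) _
      _ = _ := by rw [e3, e4]; ring
  have hmain2 : I ≤ ENNReal.ofReal (C * r) * K +
      ENNReal.ofReal (C * (r - s) * (2 ^ (s - 1) / (s - 1))) * I := by
    have h1 : I = ENNReal.ofReal (r - s) * (ENNReal.ofReal (1 / (r - s)) * I) := by
      rw [mul_left_comm]; exact hinv _ hq I
    have h2 : ENNReal.ofReal (r - s) * (ENNReal.ofReal (1 / (r - s)) * K) = K := by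
      rw [mul_left_comm]; exact (hinv _ hq K).symm
    -- The two terms in `k` add up to `1 + (r - s) / s = r / s ≤ r`, whence the factor `C * r`,
    -- uniform in `s`.
    have h3 : K + ENNReal.ofReal (r - s) * (ENNReal.ofReal (1 / s) * K) ≤ ENNReal.ofReal r * K := by
      rw [← mul_assoc, ← ENNReal.ofReal_mul hq.le]
      nth_rewrite 1 [← one_mul K]
      rw [← add_mul, ← ENNReal.ofReal_one, ← ENNReal.ofReal_add zero_le_one (by positivity)]
      gcongr
      rw [show 1 + (r - s) * (1 / s) = r / s by field_simp; ring]
      exact div_le_self (by linarith) hs.le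
    rw [h1]
    calc _ ≤ ENNReal.ofReal (r - s) * (ENNReal.ofReal C * (ENNReal.ofReal (1 / (r - s)) * K +
          ENNReal.ofReal (1 / s) * K + ENNReal.ofReal (2 ^ (s - 1) / (s - 1)) * I)) := by gcongr
      _ = ENNReal.ofReal C * (ENNReal.ofReal (r - s) * (ENNReal.ofReal (1 / (r - s)) * K) +
          ENNReal.ofReal (r - s) * (ENNReal.ofReal (1 / s) * K)) +
          ENNReal.ofReal C * ENNReal.ofReal (r - s) *
            ENNReal.ofReal (2 ^ (s - 1) / (s - 1)) * I := by ring
      _ ≤ _ := by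
          rw [h2, ← h1, ← ENNReal.ofReal_mul hC, ← ENNReal.ofReal_mul (by positivity)]
          refine add_le_add ?_ le_rfl
          rw [ENNReal.ofReal_mul hC (q := r), mul_assoc]
          exact mul_le_mul' le_rfl h3
  refine le_mul_two_of_le_add_half ?_ hfin hmain2
  rw [← ENNReal.ofReal_ofNat 2, ← ENNReal.ofReal_inv_of_pos two_pos]
  exact ENNReal.ofReal_le_ofReal (by linarith)

end LevelSets

/-! ### Norms as integrals of real powers -/

section Norms

variable {α : Type*} [MeasurableSpace α] {μ : Measure α} {E : Type*} [NormedAddCommGroup E]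

theorem lintegral_ofReal_norm_rpow {r : ℝ} (hr : 0 < r) (f : α → E) :
    ∫⁻ a, ENNReal.ofReal (‖f a‖ ^ r) ∂μ = eLpNorm f (ENNReal.ofReal r) μ ^ r := by
  rw [eLpNorm_eq_lintegral_rpow_enorm_toReal (by simpa using hr) ENNReal.ofReal_ne_top,
    ENNReal.toReal_ofReal hr.le, ← ENNReal.rpow_mul, one_div_mul_cancel hr.ne', ENNReal.rpow_one]
  refine lintegral_congr fun a => ?_
  rw [← ENNReal.ofReal_rpow_of_nonneg (norm_nonneg _) hr.le, ofReal_norm]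

theorem memLp_of_lintegral_ofReal_norm_rpow {r : ℝ} (hr : 0 < r) {f : α → E}
    (hf : AEStronglyMeasurable f μ) (h : ∫⁻ a, ENNReal.ofReal (‖f a‖ ^ r) ∂μ ≠ ⊤) :
    MemLp f (ENNReal.ofReal r) μ := by
  refine ⟨hf, ?_⟩
  rw [lintegral_ofReal_norm_rpow hr] at h
  by_contra htop
  rw [not_lt, top_le_iff] at htop
  exact h (by rw [htop, ENNReal.top_rpow_of_pos hr])

theorem lintegral_ofReal_norm_rpow_ne_top {r : ℝ} (hr : 0 < r) {f : α → E}
    (hf : MemLp f (ENNReal.ofReal r) μ) : ∫⁻ a, ENNReal.ofReal (‖f a‖ ^ r) ∂μ ≠ ⊤ := by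
  rw [lintegral_ofReal_norm_rpow hr]
  exact ENNReal.rpow_ne_top_of_nonneg hr.le hf.2.ne

theorem lintegral_ofReal_norm_rpow_Lp {r : ℝ} (hr : 0 < r) (f : Lp E (ENNReal.ofReal r) μ) :
    ∫⁻ a, ENNReal.ofReal (‖f a‖ ^ r) ∂μ = ENNReal.ofReal (‖f‖ ^ r) := by
  rw [lintegral_ofReal_norm_rpow hr, Lp.norm_def,
    ← ENNReal.ofReal_rpow_of_nonneg ENNReal.toReal_nonneg hr.le, ENNReal.ofReal_toReal (Lp.eLpNorm_ne_top f)]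

theorem add_rpow_le_two_rpow_mul {a b r : ℝ} (ha : 0 ≤ a) (hb : 0 ≤ b) (hr : 0 ≤ r) :
    (a + b) ^ r ≤ 2 ^ r * (a ^ r + b ^ r) := by
  wlog hab : a ≤ b generalizing a b
  · rw [add_comm a b, add_comm (a ^ r)]
    exact this hb ha (le_of_not_ge hab)
  calc (a + b) ^ r ≤ (2 * b) ^ r := Real.rpow_le_rpow (by positivity) (by linarith) hr
    _ = 2 ^ r * b ^ r := Real.mul_rpow two_pos.le hb
    _ ≤ _ := by
      have := Real.rpow_nonneg ha r
      gcongr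
      linarith

theorem lintegral_ofReal_add_rpow_le {r : ℝ} (hr : 0 ≤ r) {f g : α → ℝ} (hf : AEMeasurable f μ)
    (hf0 : 0 ≤ f) (hg0 : 0 ≤ g) :
    ∫⁻ a, ENNReal.ofReal ((f a + g a) ^ r) ∂μ ≤ ENNReal.ofReal (2 ^ r) *
      ((∫⁻ a, ENNReal.ofReal (f a ^ r) ∂μ) + ∫⁻ a, ENNReal.ofReal (g a ^ r) ∂μ) := by
  rw [← lintegral_add_left' (hf.pow_const r).ennreal_ofReal,
    ← lintegral_const_mul' _ _ ENNReal.ofReal_ne_top]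
  refine lintegral_mono fun a => ?_
  rw [← ENNReal.ofReal_add (Real.rpow_nonneg (hf0 a) _) (Real.rpow_nonneg (hg0 a) _),
    ← ENNReal.ofReal_mul (by positivity)]
  exact ENNReal.ofReal_le_ofReal (add_rpow_le_two_rpow_mul (hf0 a) (hg0 a) hr)

end Norms

/-! ### Level set inequalities from the a priori estimate -/

section Estimates

variable {D X : Type*} [NormedAddCommGroup D] [NormedSpace ℂ D] [CompleteSpace D]
  [NormedAddCommGroup X] [NormedSpace ℂ X] [CompleteSpace X]
  {ι : D →L[ℂ] X} {T : ℝ} {B : ℝ → D →L[ℂ] X}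

/-- The estimate `‖u‖_{L^r(J; D)} + ‖u'‖_{L^r(J; X)} ≤ A ‖u' + B(·) u‖_{L^r(J; X)}`. -/
def AprioriEstimate (ι : D →L[ℂ] X) (T r A : ℝ) (B : ℝ → D →L[ℂ] X) : Prop :=
  ∀ (u : ℝ → D) (w : ℝ → X), MemLp u (ENNReal.ofReal r) (timeMeasure T) →
    MemLp w (ENNReal.ofReal r) (timeMeasure T) →
    (∀ᵐ t ∂(timeMeasure T), ι (u t) = ∫ τ in 0..t, w τ) →
    ∫⁻ t, ENNReal.ofReal ((‖u t‖ + ‖w t‖) ^ r) ∂(timeMeasure T) ≤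
      ENNReal.ofReal A * ∫⁻ t, ENNReal.ofReal (‖w t + B t (u t)‖ ^ r) ∂(timeMeasure T)

/-- Bounded inverse theorem. The product norm dominates both components, which gives `c ^ r` twice,
and `2 ^ r` pays for the power of the sum. -/
theorem exists_aprioriEstimate {r : ℝ} (hr : 1 ≤ r) [Fact (1 ≤ ENNReal.ofReal r)]
    (hB : IsAdmissible ι T B)
    (hbij : Function.Bijective (parabolicOp hB (ENNReal.ofReal r))) :
    ∃ A : ℝ, 0 ≤ A ∧ AprioriEstimate ι T r A B := by
  have hr0 : 0 < r := by linarith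
  let e := ContinuousLinearEquiv.ofBijective (parabolicOp hB (ENNReal.ofReal r))
    (LinearMap.ker_eq_bot.2 hbij.1) (LinearMap.range_eq_top.2 hbij.2)
  set c : ℝ := ‖(e.symm : Lp X (ENNReal.ofReal r) (timeMeasure T) →L[ℂ]
    maxRegSpace ι T (ENNReal.ofReal r))‖ with hc
  have hc0 : 0 ≤ c := norm_nonneg _
  refine ⟨2 ^ r * (c ^ r + c ^ r), by positivity, fun u w hu hw h => ?_⟩
  set x : maxRegSpace ι T (ENNReal.ofReal r) := ⟨_, toLp_mem_maxRegSpace hu hw h⟩ with hx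
  have hxle : ‖x‖ ≤ c * ‖parabolicOp hB (ENNReal.ofReal r) x‖ := by
    have h1 := (e.symm : Lp X (ENNReal.ofReal r) (timeMeasure T) →L[ℂ]
      maxRegSpace ι T (ENNReal.ofReal r)).le_opNorm (e x)
    rw [ContinuousLinearEquiv.coe_coe, e.symm_apply_apply] at h1
    exact h1
  have hrhs : ∫⁻ t, ENNReal.ofReal (‖w t + B t (u t)‖ ^ r) ∂(timeMeasure T) =
      ENNReal.ofReal (‖parabolicOp hB (ENNReal.ofReal r) x‖ ^ r) := by
    rw [← lintegral_ofReal_norm_rpow_Lp hr0]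
    refine lintegral_congr_ae ?_
    filter_upwards [coeFn_parabolicOp hB _ x, hu.coeFn_toLp, hw.coeFn_toLp] with t h1 h2 h3
    rw [h1, hx, h2, h3]
  have hpart : ∀ N : ℝ, 0 ≤ N → N ≤ ‖x‖ → ENNReal.ofReal (N ^ r) ≤
      ENNReal.ofReal (c ^ r * ‖parabolicOp hB (ENNReal.ofReal r) x‖ ^ r) := by
    intro N hN hNx
    rw [← Real.mul_rpow hc0 (norm_nonneg _)]
    exact ENNReal.ofReal_le_ofReal (Real.rpow_le_rpow hN (hNx.trans hxle) hr0.le)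
  have h1 : ∫⁻ t, ENNReal.ofReal (‖u t‖ ^ r) ∂(timeMeasure T) ≤
      ENNReal.ofReal (c ^ r * ‖parabolicOp hB (ENNReal.ofReal r) x‖ ^ r) := by
    refine le_trans (le_of_eq ?_) (hpart ‖x.1.1‖ (norm_nonneg _) (norm_fst_le x.1))
    rw [← lintegral_ofReal_norm_rpow_Lp hr0]
    refine lintegral_congr_ae ?_
    filter_upwards [hu.coeFn_toLp] with t h1
    rw [hx, h1]
  have h2 : ∫⁻ t, ENNReal.ofReal (‖w t‖ ^ r) ∂(timeMeasure T) ≤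
      ENNReal.ofReal (c ^ r * ‖parabolicOp hB (ENNReal.ofReal r) x‖ ^ r) := by
    refine le_trans (le_of_eq ?_) (hpart ‖x.1.2‖ (norm_nonneg _) (norm_snd_le x.1))
    rw [← lintegral_ofReal_norm_rpow_Lp hr0]
    refine lintegral_congr_ae ?_
    filter_upwards [hw.coeFn_toLp] with t h1
    rw [hx, h1]
  refine (lintegral_ofReal_add_rpow_le hr0.le hu.1.norm.aemeasurable (fun _ => norm_nonneg _)
    (fun _ => norm_nonneg _)).trans ?_
  rw [hrhs, ← ENNReal.ofReal_mul (by positivity), mul_assoc, ENNReal.ofReal_mul (by positivity),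
    add_mul, ENNReal.ofReal_add (by positivity) (by positivity)]
  gcongr

theorem memLp_of_truncation {E : Type*} [NormedAddCommGroup E] {μ : Measure ℝ}
    [IsFiniteMeasure μ] {p : ℝ≥0∞} {u v : ℝ → E} {c : ℝ} {O : Set ℝ} (hu : MemLp u p μ)
    (hv : AEStronglyMeasurable v μ) (hc : 0 ≤ c) (h1 : ∀ᵐ t ∂μ, t ∉ O → v t = u t)
    (h2 : ∀ᵐ t ∂μ, t ∈ O → ‖v t‖ ≤ c) : MemLp v p μ := by
  refine (hu.norm.add (memLp_const c)).mono hv ?_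
  filter_upwards [h1, h2] with t h3 h4
  rw [Pi.add_apply, Real.norm_of_nonneg (by positivity)]
  by_cases ht : t ∈ O
  · linarith [h4 ht, norm_nonneg (u t)]
  · rw [h3 ht]; linarith

theorem ofReal_rpow_mul_measure_le {μ : Measure ℝ} {l r : ℝ} (hl : 0 < l) {O : Set ℝ} {J : ℝ≥0∞}
    (hO : μ O ≤ ENNReal.ofReal (10 / l) * J) :
    ENNReal.ofReal (l ^ r) * μ O ≤ ENNReal.ofReal 10 * (ENNReal.ofReal (l ^ (r - 1)) * J) := by
  calc _ ≤ ENNReal.ofReal (l ^ r) * (ENNReal.ofReal (10 / l) * J) := by gcongr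
    _ = _ := by
      rw [← mul_assoc, ← mul_assoc, ← ENNReal.ofReal_mul (by positivity),
        ← ENNReal.ofReal_mul (by positivity), Real.rpow_sub hl, Real.rpow_one]
      congr 2; ring

/-- Almost everywhere `{l < h}` lies in the truncation set `O`, where `h` differs from `‖u - v‖ + ‖w
- z‖` by at most `20 * l`. The a priori estimate is applied to `(u - v, w - z)`: its right side
vanishes off `O` and is at most `k + 20 * b * l` on `O`. All terms `l ^ r |O|` are then paid by the
measure bound for `O`. -/
theorem level_gt_of_aprioriEstimate {r A b : ℝ} (hr : 1 < r) (hA : 0 ≤ A) (hb : 1 ≤ b)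
    (hBb : ∀ u : ℝ → D, ∀ᵐ t ∂(timeMeasure T), ‖B t (u t)‖ ≤ b * ‖u t‖)
    (hap : AprioriEstimate ι T r A B) {u : ℝ → D} {w : ℝ → X} {k : ℝ → ℝ}
    (hu : MemLp u (ENNReal.ofReal r) (timeMeasure T))
    (hw : MemLp w (ENNReal.ofReal r) (timeMeasure T))
    (h : ∀ᵐ t ∂(timeMeasure T), ι (u t) = ∫ τ in 0..t, w τ)
    (hum : StronglyMeasurable u) (hwm : StronglyMeasurable w) (hkm : Measurable k) (hk0 : 0 ≤ k)
    (hk : ∀ᵐ t ∂(timeMeasure T), ‖w t + B t (u t)‖ = k t) {l : ℝ} (hl : 0 < l) :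
    ∫⁻ t in {t | l < ‖u t‖ + ‖w t‖}, ENNReal.ofReal ((‖u t‖ + ‖w t‖) ^ r) ∂(timeMeasure T) ≤
      ENNReal.ofReal (10 * (2 ^ r * (A * 2 ^ r * (2 + (20 * b) ^ r) + 20 ^ r))) *
      ((∫⁻ t in {t | l < k t}, ENNReal.ofReal (k t ^ r) ∂(timeMeasure T)) +
        ENNReal.ofReal (l ^ (r - 1)) * ∫⁻ t in {t | l / 2 < ‖u t‖ + ‖w t‖},
          ENNReal.ofReal (‖u t‖ + ‖w t‖) ∂(timeMeasure T)) := by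
  have hr0 : 0 < r := by linarith
  have hp : 1 ≤ ENNReal.ofReal r := by simpa using ENNReal.ofReal_le_ofReal hr.le
  obtain ⟨O, v, z, hO, hv, hz, hvz, hout, hin, hmeas⟩ :=
    exists_truncation (hu.integrable hp) (hw.integrable hp) h hl
  have hvL : MemLp v (ENNReal.ofReal r) (timeMeasure T) :=
    memLp_of_truncation hu hv (c := 8 * l) (by positivity)
      (hout.mono fun t ht h' => (ht h').1) (hin.mono fun t ht h' => (ht h').1)
  have hzL : MemLp z (ENNReal.ofReal r) (timeMeasure T) :=
    memLp_of_truncation hw hz (c := 12 * l) (by positivity)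
      (hout.mono fun t ht h' => (ht h').2.1) (hin.mono fun t ht h' => (ht h').2)
  have hdiff : ∀ᵐ t ∂(timeMeasure T), ι (u t - v t) = ∫ τ in 0..t, (w τ - z τ) := by
    filter_upwards [h, hvz, ae_timeMeasure_mem T] with t h1 h2 h3
    rw [map_sub, h1, h2, intervalIntegral.integral_sub
      (intervalIntegrable_of_timeMeasure h3 (hw.integrable hp))
      (intervalIntegrable_of_timeMeasure h3 (hzL.integrable hp))]
  have hest := hap (fun t => u t - v t) (fun t => w t - z t) (hu.sub hvL) (hw.sub hzL) hdiff
  set S := ∫⁻ t in {t | l < k t}, ENNReal.ofReal (k t ^ r) ∂(timeMeasure T) with hS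
  set M := ENNReal.ofReal (l ^ r) * timeMeasure T O with hM
  have hMO : ∀ c : ℝ, 0 ≤ c → ∫⁻ t, O.indicator (fun _ => ENNReal.ofReal (c * l ^ r)) t
      ∂(timeMeasure T) = ENNReal.ofReal c * M := by
    intro c hc
    rw [lintegral_indicator hO, setLIntegral_const, ENNReal.ofReal_mul hc, hM, mul_assoc]
  have hkS : MeasurableSet {t | l < k t} := measurableSet_lt measurable_const hkm
  -- the right hand side of the a priori estimate is supported in `O`
  have hrhs : ∫⁻ t, ENNReal.ofReal (‖w t - z t + B t (u t - v t)‖ ^ r) ∂(timeMeasure T) ≤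
      ENNReal.ofReal (2 ^ r) * (S + ENNReal.ofReal (1 + (20 * b) ^ r) * M) := by
    rw [← hMO _ (by positivity), hS, ← lintegral_indicator hkS, ← lintegral_add_left
      ((hkm.pow_const r).ennreal_ofReal.indicator hkS),
      ← lintegral_const_mul' _ _ ENNReal.ofReal_ne_top]
    refine lintegral_mono_ae ?_
    filter_upwards [hout, hin, hk, hBb v] with t h1 h2 h3 h4
    by_cases ht : t ∈ O
    · obtain ⟨h5, h6⟩ := h2 ht
      have h7 : ‖w t - z t + B t (u t - v t)‖ ≤ k t + 20 * b * l := by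
        calc ‖w t - z t + B t (u t - v t)‖ = ‖(w t + B t (u t)) - (z t + B t (v t))‖ := by
              rw [map_sub]; congr 1; abel
          _ ≤ k t + (‖z t‖ + ‖B t (v t)‖) := by
              rw [← h3]
              exact (norm_sub_le _ _).trans (by gcongr; exact norm_add_le _ _)
          _ ≤ k t + 20 * b * l := by nlinarith
      have h8 : k t ^ r ≤ {t | l < k t}.indicator (fun t => k t ^ r) t + l ^ r := by
        by_cases hlt : l < k t
        · rw [indicator_of_mem (show t ∈ {t | l < k t} from hlt)]
          linarith [Real.rpow_nonneg hl.le r]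
        · rw [indicator_of_notMem (show t ∉ {t | l < k t} from hlt), zero_add]
          exact Real.rpow_le_rpow (hk0 t) (not_lt.1 hlt) hr0.le
      have h9 : {t | l < k t}.indicator (fun t => ENNReal.ofReal (k t ^ r)) t =
          ENNReal.ofReal ({t | l < k t}.indicator (fun t => k t ^ r) t) := by
        by_cases hlt : t ∈ {t | l < k t} <;> simp [indicator, hlt]
      have h10 : 0 ≤ {t | l < k t}.indicator (fun t => k t ^ r) t :=
        indicator_nonneg (fun t _ => Real.rpow_nonneg (hk0 t) r) t
      rw [indicator_of_mem ht, h9, ← ENNReal.ofReal_add h10 (by positivity),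
        ← ENNReal.ofReal_mul (by positivity)]
      refine ENNReal.ofReal_le_ofReal ?_
      calc _ ≤ (k t + 20 * b * l) ^ r := Real.rpow_le_rpow (norm_nonneg _) h7 hr0.le
        _ ≤ 2 ^ r * (k t ^ r + (20 * b * l) ^ r) :=
            add_rpow_le_two_rpow_mul (hk0 t) (by positivity) hr0.le
        _ ≤ 2 ^ r * (({t | l < k t}.indicator (fun t => k t ^ r) t + l ^ r) +
              (20 * b) ^ r * l ^ r) := by
            rw [Real.mul_rpow (by positivity) hl.le]
            gcongr
        _ = _ := by ring
    · obtain ⟨h5, h6, -⟩ := h1 ht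
      rw [h5, h6, sub_self, sub_self, map_zero, add_zero, norm_zero, Real.zero_rpow hr0.ne',
        ENNReal.ofReal_zero]
      exact zero_le
  have hlhs : ∫⁻ t in {t | l < ‖u t‖ + ‖w t‖}, ENNReal.ofReal ((‖u t‖ + ‖w t‖) ^ r)
      ∂(timeMeasure T) ≤ ENNReal.ofReal (2 ^ r) *
        ((∫⁻ t, ENNReal.ofReal ((‖u t - v t‖ + ‖w t - z t‖) ^ r) ∂(timeMeasure T)) +
          ENNReal.ofReal (20 ^ r) * M) := by
    have hhm : MeasurableSet {t | l < ‖u t‖ + ‖w t‖} :=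
      measurableSet_lt measurable_const (hum.norm.measurable.add hwm.norm.measurable)
    have hem : AEMeasurable (fun t => ENNReal.ofReal ((‖u t - v t‖ + ‖w t - z t‖) ^ r))
        (timeMeasure T) :=
      (((hu.1.sub hv).norm.aemeasurable.add (hw.1.sub hz).norm.aemeasurable).pow_const
        r).ennreal_ofReal
    rw [← hMO _ (by positivity), ← lintegral_indicator hhm, ← lintegral_add_left' hem,
      ← lintegral_const_mul' _ _ ENNReal.ofReal_ne_top]
    refine lintegral_mono_ae ?_
    filter_upwards [hout, hin] with t h1 h2
    by_cases hlt : l < ‖u t‖ + ‖w t‖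
    · have ht : t ∈ O := by
        by_contra ht
        exact absurd (h1 ht).2.2 (not_le.2 hlt)
      obtain ⟨h5, h6⟩ := h2 ht
      rw [indicator_of_mem (show t ∈ {t | l < ‖u t‖ + ‖w t‖} from hlt), indicator_of_mem ht,
        ← ENNReal.ofReal_add (by positivity) (by positivity), ← ENNReal.ofReal_mul (by positivity)]
      refine ENNReal.ofReal_le_ofReal ?_
      have h7 : ‖u t‖ + ‖w t‖ ≤ (‖u t - v t‖ + ‖w t - z t‖) + 20 * l := by
        linarith [norm_sub_norm_le (u t) (v t), norm_sub_norm_le (w t) (z t)]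
      calc _ ≤ ((‖u t - v t‖ + ‖w t - z t‖) + 20 * l) ^ r :=
            Real.rpow_le_rpow (by positivity) h7 hr0.le
        _ ≤ _ := add_rpow_le_two_rpow_mul (by positivity) (by positivity) hr0.le
        _ = _ := by rw [Real.mul_rpow (by positivity) hl.le]
    · rw [indicator_of_notMem (show t ∉ {t | l < ‖u t‖ + ‖w t‖} from hlt)]
      exact zero_le
  have hMJ := ofReal_rpow_mul_measure_le (r := r) hl hmeas
  rw [← hM] at hMJ
  set J := ENNReal.ofReal (l ^ (r - 1)) * ∫⁻ t in {t | l / 2 < ‖u t‖ + ‖w t‖},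
    ENNReal.ofReal (‖u t‖ + ‖w t‖) ∂(timeMeasure T) with hJ
  have hSM : S + M ≤ ENNReal.ofReal 10 * (S + J) := by
    rw [mul_add]
    refine add_le_add ?_ hMJ
    nth_rewrite 1 [← one_mul S]
    gcongr
    simp
  have hSM1 : S + ENNReal.ofReal (1 + (20 * b) ^ r) * M ≤
      ENNReal.ofReal (2 + (20 * b) ^ r) * (S + M) := by
    rw [mul_add]
    have hb0 : 0 ≤ (20 * b) ^ r := by positivity
    refine add_le_add ?_ ?_
    · nth_rewrite 1 [← one_mul S]
      gcongr
      rw [← ENNReal.ofReal_one]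
      exact ENNReal.ofReal_le_ofReal (by linarith)
    · gcongr
      norm_num
  calc _ ≤ _ := hlhs
    _ ≤ ENNReal.ofReal (2 ^ r) * (ENNReal.ofReal A * (ENNReal.ofReal (2 ^ r) *
          (ENNReal.ofReal (2 + (20 * b) ^ r) * (S + M))) + ENNReal.ofReal (20 ^ r) * (S + M)) := by
        gcongr
        · exact hest.trans (mul_le_mul' le_rfl (hrhs.trans (mul_le_mul' le_rfl hSM1)))
        · exact le_add_self
    _ = ENNReal.ofReal (2 ^ r * (A * 2 ^ r * (2 + (20 * b) ^ r) + 20 ^ r)) * (S + M) := by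
        have hc : 0 ≤ 2 + (20 * b) ^ r := by positivity
        generalize 2 + (20 * b) ^ r = c at hc ⊢
        rw [ENNReal.ofReal_mul (by positivity), ENNReal.ofReal_add (by positivity) (by positivity),
          ENNReal.ofReal_mul (by positivity), ENNReal.ofReal_mul hA]
        ring
    _ ≤ ENNReal.ofReal (2 ^ r * (A * 2 ^ r * (2 + (20 * b) ^ r) + 20 ^ r)) *
          (ENNReal.ofReal 10 * (S + J)) := by gcongr
    _ = _ := by
        rw [← mul_assoc, ← ENNReal.ofReal_mul (by positivity), mul_comm _ (10 : ℝ)]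

/-- The truncated pair is bounded, so the estimate at `r` applies to it even though `u` and `w` are
merely integrable. Off `O` it coincides with `(u, w)`; on `O` everything is of size `l` and costs a
multiple of `l ^ r |O|`. -/
theorem level_le_of_aprioriEstimate {r A b : ℝ} (hr : 1 < r) (hA : 0 ≤ A) (hb : 1 ≤ b)
    (hBb : ∀ u : ℝ → D, ∀ᵐ t ∂(timeMeasure T), ‖B t (u t)‖ ≤ b * ‖u t‖)
    (hap : AprioriEstimate ι T r A B) {u : ℝ → D} {w : ℝ → X} {k : ℝ → ℝ}
    (hu : Integrable u (timeMeasure T)) (hw : Integrable w (timeMeasure T))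
    (h : ∀ᵐ t ∂(timeMeasure T), ι (u t) = ∫ τ in 0..t, w τ)
    (hum : StronglyMeasurable u) (hwm : StronglyMeasurable w) (hkm : Measurable k)
    (hk : ∀ᵐ t ∂(timeMeasure T), ‖w t + B t (u t)‖ = k t) {l : ℝ} (hl : 0 < l) :
    ∫⁻ t in {t | ‖u t‖ + ‖w t‖ ≤ l}, ENNReal.ofReal ((‖u t‖ + ‖w t‖) ^ r) ∂(timeMeasure T) ≤
      ENNReal.ofReal (10 * (A * (1 + (20 * b) ^ r) + 1)) *
      ((∫⁻ t in {t | k t ≤ l}, ENNReal.ofReal (k t ^ r) ∂(timeMeasure T)) +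
        ENNReal.ofReal (l ^ r) * timeMeasure T {t | l < k t} +
        ENNReal.ofReal (l ^ (r - 1)) * ∫⁻ t in {t | l / 2 < ‖u t‖ + ‖w t‖},
          ENNReal.ofReal (‖u t‖ + ‖w t‖) ∂(timeMeasure T)) := by
  have hr0 : 0 < r := by linarith
  obtain ⟨O, v, z, hO, hv, hz, hvz, hout, hin, hmeas⟩ := exists_truncation hu hw h hl
  have hvb : ∀ᵐ t ∂(timeMeasure T), ‖v t‖ ≤ 12 * l := by
    filter_upwards [hout, hin] with t h1 h2
    by_cases ht : t ∈ O
    · linarith [(h2 ht).1]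
    · obtain ⟨h3, -, h4⟩ := h1 ht
      rw [h3]; linarith [norm_nonneg (u t), norm_nonneg (w t)]
  have hzb : ∀ᵐ t ∂(timeMeasure T), ‖z t‖ ≤ 12 * l := by
    filter_upwards [hout, hin] with t h1 h2
    by_cases ht : t ∈ O
    · exact (h2 ht).2
    · obtain ⟨-, h3, h4⟩ := h1 ht
      rw [h3]; linarith [norm_nonneg (u t), norm_nonneg (w t)]
  have hest := hap v z (MemLp.of_bound hv _ hvb) (MemLp.of_bound hz _ hzb) hvz
  set S := ∫⁻ t in {t | k t ≤ l}, ENNReal.ofReal (k t ^ r) ∂(timeMeasure T) with hS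
  set M := ENNReal.ofReal (l ^ r) * timeMeasure T O with hM
  set N := ENNReal.ofReal (l ^ r) * timeMeasure T {t | l < k t} with hN
  have hconst : ∀ (U : Set ℝ), MeasurableSet U → ∀ c : ℝ, 0 ≤ c →
      ∫⁻ t, U.indicator (fun _ => ENNReal.ofReal (c * l ^ r)) t ∂(timeMeasure T) =
        ENNReal.ofReal c * (ENNReal.ofReal (l ^ r) * timeMeasure T U) := by
    intro U hU c hc
    rw [lintegral_indicator hU, setLIntegral_const, ENNReal.ofReal_mul hc, mul_assoc]
  have hkS : MeasurableSet {t | k t ≤ l} := measurableSet_le hkm measurable_const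
  have hkN : MeasurableSet {t | l < k t} := measurableSet_lt measurable_const hkm
  have hrhs : ∫⁻ t, ENNReal.ofReal (‖z t + B t (v t)‖ ^ r) ∂(timeMeasure T) ≤
      S + (ENNReal.ofReal ((20 * b) ^ r) * N + ENNReal.ofReal ((20 * b) ^ r) * M) := by
    rw [hN, hM, ← hconst _ hkN _ (by positivity), ← hconst _ hO _ (by positivity), hS,
      ← lintegral_indicator hkS, ← lintegral_add_left (measurable_const.indicator hkN),
      ← lintegral_add_left ((hkm.pow_const r).ennreal_ofReal.indicator hkS)]
    refine lintegral_mono_ae ?_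
    filter_upwards [hout, hin, hk, hBb v] with t h1 h2 h3 h4
    by_cases ht : t ∈ O
    · obtain ⟨h5, h6⟩ := h2 ht
      have h7 : ‖z t + B t (v t)‖ ≤ 20 * b * l :=
        (norm_add_le _ _).trans (by nlinarith)
      rw [indicator_of_mem ht]
      refine le_trans ?_ (le_trans le_add_self le_add_self)
      rw [← Real.mul_rpow (by positivity) hl.le]
      exact ENNReal.ofReal_le_ofReal (Real.rpow_le_rpow (norm_nonneg _) h7 hr0.le)
    · obtain ⟨h5, h6, h7⟩ := h1 ht
      by_cases hkl : k t ≤ l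
      · rw [indicator_of_mem (show t ∈ {t | k t ≤ l} from hkl)]
        refine le_trans (le_of_eq ?_) le_self_add
        rw [h5, h6, h3]
      -- Off `O` with `k > l`: here `h ≤ l` bounds the right side by `b * l`, so only the measure of
      -- `{l < k}` enters.
      · rw [indicator_of_mem (show t ∈ {t | l < k t} from not_le.1 hkl)]
        refine le_trans ?_ (le_trans le_self_add le_add_self)
        rw [← Real.mul_rpow (by positivity) hl.le]
        refine ENNReal.ofReal_le_ofReal (Real.rpow_le_rpow (norm_nonneg _) ?_ hr0.le)
        refine (norm_add_le _ _).trans ?_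
        rw [h5] at h4 ⊢
        rw [h6]
        nlinarith [norm_nonneg (u t), norm_nonneg (w t), mul_nonneg (sub_nonneg.2 hb) hl.le,
          mul_le_mul_of_nonneg_left h7 (zero_le_one.trans hb),
          mul_nonneg (sub_nonneg.2 hb) (norm_nonneg (w t))]
  have hlhs : ∫⁻ t in {t | ‖u t‖ + ‖w t‖ ≤ l}, ENNReal.ofReal ((‖u t‖ + ‖w t‖) ^ r)
      ∂(timeMeasure T) ≤
        (∫⁻ t, ENNReal.ofReal ((‖v t‖ + ‖z t‖) ^ r) ∂(timeMeasure T)) + M := by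
    have hhm : MeasurableSet {t | ‖u t‖ + ‖w t‖ ≤ l} :=
      measurableSet_le (hum.norm.measurable.add hwm.norm.measurable) measurable_const
    have hem : AEMeasurable (fun t => ENNReal.ofReal ((‖v t‖ + ‖z t‖) ^ r)) (timeMeasure T) :=
      ((hv.norm.aemeasurable.add hz.norm.aemeasurable).pow_const r).ennreal_ofReal
    have hM1 : M = ∫⁻ t, O.indicator (fun _ => ENNReal.ofReal (l ^ r)) t ∂(timeMeasure T) := by
      rw [lintegral_indicator hO, setLIntegral_const, hM]
    rw [hM1, ← lintegral_indicator hhm, ← lintegral_add_left' hem]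
    refine lintegral_mono_ae ?_
    filter_upwards [hout] with t h1
    by_cases hlt : ‖u t‖ + ‖w t‖ ≤ l
    · rw [indicator_of_mem (show t ∈ {t | ‖u t‖ + ‖w t‖ ≤ l} from hlt)]
      by_cases ht : t ∈ O
      · rw [indicator_of_mem ht]
        refine le_trans ?_ le_add_self
        exact ENNReal.ofReal_le_ofReal (Real.rpow_le_rpow (by positivity) hlt hr0.le)
      · obtain ⟨h5, h6, -⟩ := h1 ht
        rw [h5, h6]
        exact le_self_add
    · rw [indicator_of_notMem (show t ∉ {t | ‖u t‖ + ‖w t‖ ≤ l} from hlt)]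
      exact zero_le
  have hMJ := ofReal_rpow_mul_measure_le (r := r) hl hmeas
  rw [← hM] at hMJ
  set J := ENNReal.ofReal (l ^ (r - 1)) * ∫⁻ t in {t | l / 2 < ‖u t‖ + ‖w t‖},
    ENNReal.ofReal (‖u t‖ + ‖w t‖) ∂(timeMeasure T) with hJ
  have hSM : S + N + M ≤ ENNReal.ofReal 10 * (S + N + J) := by
    rw [mul_add]
    refine add_le_add ?_ hMJ
    nth_rewrite 1 [← one_mul (S + N)]
    gcongr
    simp
  have hSM1 : S + (ENNReal.ofReal ((20 * b) ^ r) * N + ENNReal.ofReal ((20 * b) ^ r) * M) ≤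
      ENNReal.ofReal (1 + (20 * b) ^ r) * (S + N + M) := by
    have hb0 : 0 ≤ (20 * b) ^ r := by positivity
    rw [← add_assoc, mul_add, mul_add]
    gcongr
    · nth_rewrite 1 [← one_mul S]
      gcongr
      rw [← ENNReal.ofReal_one]
      exact ENNReal.ofReal_le_ofReal (by linarith)
    · linarith
    · linarith
  calc _ ≤ _ := hlhs
    _ ≤ ENNReal.ofReal A * (ENNReal.ofReal (1 + (20 * b) ^ r) * (S + N + M)) + (S + N + M) := by
        gcongr
        · exact hest.trans (mul_le_mul' le_rfl (hrhs.trans hSM1))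
        · exact le_add_self
    _ = ENNReal.ofReal (A * (1 + (20 * b) ^ r) + 1) * (S + N + M) := by
        have hc : 0 ≤ 1 + (20 * b) ^ r := by positivity
        generalize 1 + (20 * b) ^ r = c at hc ⊢
        rw [ENNReal.ofReal_add (by positivity) (by positivity), ENNReal.ofReal_mul hA,
          ENNReal.ofReal_one]
        ring
    _ ≤ ENNReal.ofReal (A * (1 + (20 * b) ^ r) + 1) * (ENNReal.ofReal 10 * (S + N + J)) := by gcongr
    _ = _ := by
        rw [← mul_assoc, ← ENNReal.ofReal_mul (by positivity), mul_comm _ (10 : ℝ)]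

end Estimates

/-! ### Transfer of maximal regularity to nearby exponents -/

section Extrapolation

variable {D X : Type*} [NormedAddCommGroup D] [NormedSpace ℂ D] [CompleteSpace D]
  [NormedAddCommGroup X] [NormedSpace ℂ X] [CompleteSpace X]
  {ι : D →L[ℂ] X} {T : ℝ} {B : ℝ → D →L[ℂ] X}

theorem memLp_mono_exponent {E : Type*} [NormedAddCommGroup E] {r s : ℝ} (hrs : r ≤ s) {f : ℝ → E}
    (hf : MemLp f (ENNReal.ofReal s) (timeMeasure T)) :
    MemLp f (ENNReal.ofReal r) (timeMeasure T) :=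
  hf.mono_exponent (ENNReal.ofReal_le_ofReal hrs)

/-- Solutions in `MR_0^r` with right hand sides in `L^s` belong to `MR_0^s` if `s > r` is close to
`r`. -/
theorem exists_constant_gt (hB : IsAdmissible ι T B) {r A : ℝ} (hr : 1 < r) (hA : 0 ≤ A)
    (hap : AprioriEstimate ι T r A B) : ∃ C : ℝ, 0 ≤ C ∧ ∀ s : ℝ, r < s →
      C * (s - r) * (2 ^ (s - 1) / (s - 1)) ≤ 1 / 2 → ∀ (u : ℝ → D) (w : ℝ → X),
        MemLp u (ENNReal.ofReal r) (timeMeasure T) → MemLp w (ENNReal.ofReal r) (timeMeasure T) →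
        (∀ᵐ t ∂(timeMeasure T), ι (u t) = ∫ τ in 0..t, w τ) →
        MemLp (fun t => w t + B t (u t)) (ENNReal.ofReal s) (timeMeasure T) →
        MemLp u (ENNReal.ofReal s) (timeMeasure T) ∧
          MemLp w (ENNReal.ofReal s) (timeMeasure T) := by
  obtain ⟨b, hb, hBb⟩ := hB.exists_bound
  refine ⟨10 * (2 ^ r * (A * 2 ^ r * (2 + (20 * b) ^ r) + 20 ^ r)), by positivity,
    fun s hrs hδ u w hu hw h hg => ?_⟩
  have hs0 : 0 < s := by linarith
  have hr0 : 0 < r := by linarith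
  set u₁ := hu.1.mk u with hu₁
  set w₁ := hw.1.mk w with hw₁
  have hue : u =ᵐ[timeMeasure T] u₁ := hu.1.ae_eq_mk
  have hwe : w =ᵐ[timeMeasure T] w₁ := hw.1.ae_eq_mk
  have hum : StronglyMeasurable u₁ := hu.1.stronglyMeasurable_mk
  have hwm : StronglyMeasurable w₁ := hw.1.stronglyMeasurable_mk
  have hu₁L := (memLp_congr_ae hue).1 hu
  have hw₁L := (memLp_congr_ae hwe).1 hw
  have h₁ : ∀ᵐ t ∂(timeMeasure T), ι (u₁ t) = ∫ τ in 0..t, w₁ τ := by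
    filter_upwards [h, hue, ae_timeMeasure_mem T] with t h1 h2 h3
    rw [← h2, h1, intervalIntegral_congr_timeMeasure h3 hwe]
  set g := hg.1.mk _ with hgdef
  have hge : (fun t => w t + B t (u t)) =ᵐ[timeMeasure T] g := hg.1.ae_eq_mk
  have hgL : MemLp g (ENNReal.ofReal s) (timeMeasure T) := (memLp_congr_ae hge).1 hg
  have hk : ∀ᵐ t ∂(timeMeasure T), ‖w₁ t + B t (u₁ t)‖ = ‖g t‖ := by
    filter_upwards [hue, hwe, hge] with t h1 h2 h3
    rw [← h1, ← h2, h3]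
  have hsum := hu₁L.norm.add hw₁L.norm
  have hfin : ∫⁻ t, ENNReal.ofReal ((‖u₁ t‖ + ‖w₁ t‖) ^ r) ∂(timeMeasure T) ≠ ⊤ := by
    have := lintegral_ofReal_norm_rpow_ne_top hr0 hsum
    refine ne_of_eq_of_ne (lintegral_congr fun t => ?_) this
    rw [Pi.add_apply, Real.norm_of_nonneg (by positivity)]
  have hmain := lintegral_rpow_le_of_level_gt (μ := timeMeasure T)
    (h := fun t => ‖u₁ t‖ + ‖w₁ t‖) (k := fun t => ‖g t‖)
    (hum.norm.measurable.add hwm.norm.measurable) hg.1.stronglyMeasurable_mk.norm.measurable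
    (fun t => by positivity) (fun t => norm_nonneg _) hr hrs (by positivity) hfin
    (fun l hl => level_gt_of_aprioriEstimate hr hA hb hBb hap hu₁L hw₁L h₁ hum hwm
      hg.1.stronglyMeasurable_mk.norm.measurable (fun t => norm_nonneg _) hk hl) hδ
  have hfin2 : ∫⁻ t, ENNReal.ofReal ((‖u₁ t‖ + ‖w₁ t‖) ^ s) ∂(timeMeasure T) ≠ ⊤ :=
    ne_top_of_le_ne_top (ENNReal.mul_ne_top (by simp) (ENNReal.mul_ne_top ENNReal.ofReal_ne_top
      (lintegral_ofReal_norm_rpow_ne_top hs0 hgL))) hmain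
  constructor
  · rw [memLp_congr_ae hue]
    refine memLp_of_lintegral_ofReal_norm_rpow hs0 hu₁L.1 (ne_top_of_le_ne_top hfin2 ?_)
    refine lintegral_mono fun t => ENNReal.ofReal_le_ofReal ?_
    exact Real.rpow_le_rpow (norm_nonneg _) (le_add_of_nonneg_right (norm_nonneg _)) hs0.le
  · rw [memLp_congr_ae hwe]
    refine memLp_of_lintegral_ofReal_norm_rpow hs0 hw₁L.1 (ne_top_of_le_ne_top hfin2 ?_)
    refine lintegral_mono fun t => ENNReal.ofReal_le_ofReal ?_
    exact Real.rpow_le_rpow (norm_nonneg _) (le_add_of_nonneg_left (norm_nonneg _)) hs0.le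

omit [CompleteSpace D] in
-- On a finite interval `L^s ⊆ L^r`: the solution at `r` exists and `hreg` raises its integrability,
-- while uniqueness at `s` is inherited from `r`.
theorem hasMaxReg_of_gt (hT : 0 < T) {r : ℝ} (hr : 1 < r) (hBr : HasMaxReg ι T r B)
    {s : ℝ} (hrs : r < s)
    (hreg : ∀ (u : ℝ → D) (w : ℝ → X),
        MemLp u (ENNReal.ofReal r) (timeMeasure T) → MemLp w (ENNReal.ofReal r) (timeMeasure T) →
        (∀ᵐ t ∂(timeMeasure T), ι (u t) = ∫ τ in 0..t, w τ) →
        MemLp (fun t => w t + B t (u t)) (ENNReal.ofReal s) (timeMeasure T) →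
        MemLp u (ENNReal.ofReal s) (timeMeasure T) ∧
          MemLp w (ENNReal.ofReal s) (timeMeasure T)) :
    HasMaxReg ι T s B := by
  have hs : 1 ≤ s := by linarith
  refine ⟨hBr.admissible, fun f hf => ?_⟩
  obtain ⟨u, hu, huniq⟩ := hBr.exists_unique f (memLp_mono_exponent hrs.le hf)
  refine ⟨u, ?_, fun v hv => huniq v ?_⟩
  · obtain ⟨h1, w, h2, h3, h4⟩ := (memMR_and_solvesAE_iff hT hr.le).1 hu
    obtain ⟨h5, h6⟩ := hreg u w h1 h2 h3 ((memLp_congr_ae h4).2 hf)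
    exact (memMR_and_solvesAE_iff hT hs).2 ⟨h5, w, h6, h3, h4⟩
  · obtain ⟨h1, w, h2, h3, h4⟩ := (memMR_and_solvesAE_iff hT hs).1 hv
    exact (memMR_and_solvesAE_iff hT hr.le).2
      ⟨memLp_mono_exponent hrs.le h1, w, memLp_mono_exponent hrs.le h2, h3, h4⟩

/-- The parabolic operator is bounded below on `MR_0^s` if `s < r` is close to `r`. -/
theorem exists_constant_lt (hB : IsAdmissible ι T B) {r A : ℝ} (hr : 1 < r) (hA : 0 ≤ A)
    (hap : AprioriEstimate ι T r A B) : ∃ C : ℝ, 0 ≤ C ∧ ∀ s : ℝ, 1 < s → s < r →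
      C * (r - s) * (2 ^ (s - 1) / (s - 1)) ≤ 1 / 2 →
      ∀ [Fact (1 ≤ ENNReal.ofReal s)] (x : maxRegSpace ι T (ENNReal.ofReal s)),
        ‖x‖ ≤ (2 * (C * r)) ^ (1 / s) * ‖parabolicOp hB (ENNReal.ofReal s) x‖ := by
  obtain ⟨b, hb, hBb⟩ := hB.exists_bound
  refine ⟨10 * (A * (1 + (20 * b) ^ r) + 1), by positivity, fun s hs hsr hδ hfact x => ?_⟩
  have hs0 : 0 < s := by linarith
  set g := parabolicOp hB (ENNReal.ofReal s) x with hg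
  have hC0 : 0 ≤ 10 * (A * (1 + (20 * b) ^ r) + 1) := by positivity
  set C := 10 * (A * (1 + (20 * b) ^ r) + 1) with hC
  have hum := Lp.stronglyMeasurable x.1.1
  have hwm := Lp.stronglyMeasurable x.1.2
  have hgm := Lp.stronglyMeasurable g
  have hk : ∀ᵐ t ∂(timeMeasure T), ‖x.1.2 t + B t (x.1.1 t)‖ = ‖g t‖ := by
    filter_upwards [coeFn_parabolicOp hB _ x] with t h1
    rw [hg, h1]
  have hfin : ∫⁻ t, ENNReal.ofReal ((‖x.1.1 t‖ + ‖x.1.2 t‖) ^ s) ∂(timeMeasure T) ≠ ⊤ := by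
    have := lintegral_ofReal_norm_rpow_ne_top hs0 ((Lp.memLp x.1.1).norm.add (Lp.memLp x.1.2).norm)
    refine ne_of_eq_of_ne (lintegral_congr fun t => ?_) this
    rw [Pi.add_apply, Real.norm_of_nonneg (by positivity)]
  have hmain := lintegral_rpow_le_of_level_le (μ := timeMeasure T)
    (h := fun t => ‖x.1.1 t‖ + ‖x.1.2 t‖) (k := fun t => ‖g t‖)
    (hum.norm.measurable.add hwm.norm.measurable) hgm.norm.measurable
    (fun t => by positivity) (fun t => norm_nonneg _) hs hsr hC0 hfin
    (fun l hl => level_le_of_aprioriEstimate hr hA hb hBb hap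
      ((Lp.memLp x.1.1).integrable hfact.out) ((Lp.memLp x.1.2).integrable hfact.out) x.2 hum hwm
      hgm.norm.measurable hk hl) hδ
  rw [lintegral_ofReal_norm_rpow_Lp hs0, ← ENNReal.ofReal_ofNat 2,
    ← ENNReal.ofReal_mul (by positivity), ← ENNReal.ofReal_mul (by norm_num), ← mul_assoc] at hmain
  have hfinal : ∀ N : ℝ, 0 ≤ N → ENNReal.ofReal (N ^ s) ≤
      ∫⁻ t, ENNReal.ofReal ((‖x.1.1 t‖ + ‖x.1.2 t‖) ^ s) ∂(timeMeasure T) →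
      N ≤ (2 * (C * r)) ^ (1 / s) * ‖g‖ := by
    intro N hN hle
    have h1 := (ENNReal.ofReal_le_ofReal_iff (by positivity)).1 (hle.trans hmain)
    rw [← Real.rpow_le_rpow_iff hN (by positivity) hs0, Real.mul_rpow (by positivity)
      (norm_nonneg _), ← Real.rpow_mul (by positivity), one_div_mul_cancel hs0.ne', Real.rpow_one]
    exact h1
  refine max_le (hfinal ‖x.1.1‖ (norm_nonneg _) ?_) (hfinal ‖x.1.2‖ (norm_nonneg _) ?_)
  · rw [← lintegral_ofReal_norm_rpow_Lp hs0]
    refine lintegral_mono fun t => ENNReal.ofReal_le_ofReal ?_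
    exact Real.rpow_le_rpow (norm_nonneg _) (le_add_of_nonneg_right (norm_nonneg _)) hs0.le
  · rw [← lintegral_ofReal_norm_rpow_Lp hs0]
    refine lintegral_mono fun t => ENNReal.ofReal_le_ofReal ?_
    exact Real.rpow_le_rpow (norm_nonneg _) (le_add_of_nonneg_left (norm_nonneg _)) hs0.le

/-- The lower bound yields injectivity and closed range. The range is dense because simple functions
lie in `L^r`, and their solutions at `r` also belong to the larger space at `s`. -/
theorem hasMaxReg_of_lt (hT : 0 < T) {r : ℝ} (hBr : HasMaxReg ι T r B)
    {s : ℝ} (hs : 1 < s) (hsr : s < r) [Fact (1 ≤ ENNReal.ofReal s)] {c : ℝ} (hc : 0 ≤ c)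
    (hest : ∀ x : maxRegSpace ι T (ENNReal.ofReal s),
        ‖x‖ ≤ c * ‖parabolicOp hBr.admissible (ENNReal.ofReal s) x‖) :
    HasMaxReg ι T s B := by
  rw [hasMaxReg_iff_bijective hT hs.le hBr.admissible,
    ContinuousLinearMap.bijective_iff_dense_range_and_antilipschitz]
  refine ⟨?_, ⟨c, hc⟩, ContinuousLinearMap.antilipschitz_of_bound _ hest⟩
  rw [← Submodule.dense_iff_topologicalClosure_eq_top]
  refine Dense.mono ?_ (Lp.simpleFunc.denseRange (E := X) (μ := timeMeasure T)
    (p := ENNReal.ofReal s) ENNReal.ofReal_ne_top)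
  rintro _ ⟨f, rfl⟩
  have hfL : MemLr T r (Lp.simpleFunc.toSimpleFunc f) :=
    SimpleFunc.memLp_of_isFiniteMeasure _ _ _
  obtain ⟨u, hu, -⟩ := hBr.exists_unique _ hfL
  obtain ⟨h1, w, h2, h3, h4⟩ := (memMR_and_solvesAE_iff hT (by linarith)).1 hu
  refine ⟨⟨_, toLp_mem_maxRegSpace (memLp_mono_exponent hsr.le h1)
    (memLp_mono_exponent hsr.le h2) h3⟩, ?_⟩
  apply Lp.ext
  filter_upwards [coeFn_parabolicOp hBr.admissible (ENNReal.ofReal s)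
      ⟨_, toLp_mem_maxRegSpace (memLp_mono_exponent hsr.le h1) (memLp_mono_exponent hsr.le h2) h3⟩,
    (memLp_mono_exponent hsr.le h1).coeFn_toLp, (memLp_mono_exponent hsr.le h2).coeFn_toLp, h4,
    Lp.simpleFunc.toSimpleFunc_eq_toFun f] with t h5 h6 h7 h8 h9
  rw [← h9, ← h8]
  refine h5.trans ?_
  simp only [h6, h7]

theorem exists_radius {r C : ℝ} (hr : 1 < r) (hC : 0 ≤ C) : ∃ δ : ℝ, 0 < δ ∧ δ ≤ (r - 1) / 2 ∧
    ∀ s : ℝ, |s - r| < δ → C * |s - r| * (2 ^ (s - 1) / (s - 1)) ≤ 1 / 2 := by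
  have h2r : (0 : ℝ) < 2 ^ r := by positivity
  -- The first bound keeps `s - 1 ≥ (r - 1) / 2`, the second keeps `2 ^ (s - 1) ≤ 2 ^ r`, and the
  -- third makes the product small; `C + 1` avoids a zero denominator.
  refine ⟨min ((r - 1) / 2) (min 1 ((r - 1) / (4 * (C + 1) * 2 ^ r))),
    lt_min (by linarith) (lt_min one_pos (div_pos (by linarith) (by positivity))),
    min_le_left _ _, fun s hs => ?_⟩
  obtain ⟨h1, h2, h3⟩ := by simpa only [lt_min_iff] using hs
  rw [lt_div_iff₀ (by positivity)] at h3
  obtain ⟨h4, -⟩ := abs_lt.1 h1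
  obtain ⟨-, h5⟩ := abs_lt.1 h2
  have h6 : (2 : ℝ) ^ (s - 1) ≤ 2 ^ r := Real.rpow_le_rpow_of_exponent_le one_le_two (by linarith)
  have hs1 : 0 < s - 1 := by linarith
  rw [← mul_div_assoc, div_le_iff₀ hs1]
  calc C * |s - r| * 2 ^ (s - 1) ≤ (C + 1) * |s - r| * 2 ^ r := by gcongr; linarith
    _ = |s - r| * (4 * (C + 1) * 2 ^ r) / 4 := by ring
    _ ≤ (r - 1) / 4 := by linarith
    _ ≤ 1 / 2 * (s - 1) := by linarith

/-- Maximal parabolic regularity is stable under small changes of the integrability exponent. The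
proof truncates the pairs `(u, u')` directly instead of interpolating between the spaces
`MR_0^p(J; D, X)`, so that no reference operator with maximal regularity is needed. -/
theorem HasMaxReg.exists_Ioo (hT : 0 < T) {r : ℝ} (hr : 1 < r) (hBr : HasMaxReg ι T r B) :
    ∃ δ : ℝ, 0 < δ ∧ δ ≤ r - 1 ∧ ∀ s ∈ Ioo (r - δ) (r + δ), HasMaxReg ι T s B := by
  have hfact : ∀ s : ℝ, 1 < s → Fact (1 ≤ ENNReal.ofReal s) := fun s hs =>
    ⟨by simpa using ENNReal.ofReal_le_ofReal hs.le⟩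
  have := hfact r hr
  obtain ⟨A, hA, hap⟩ := exists_aprioriEstimate hr.le hBr.admissible
    ((hasMaxReg_iff_bijective hT hr.le hBr.admissible).1 hBr)
  obtain ⟨C₁, hC₁, h₁⟩ := exists_constant_gt hBr.admissible hr hA hap
  obtain ⟨C₂, hC₂, h₂⟩ := exists_constant_lt hBr.admissible hr hA hap
  obtain ⟨δ₁, hδ₁, hδ₁r, hs₁⟩ := exists_radius hr hC₁
  obtain ⟨δ₂, hδ₂, hδ₂r, hs₂⟩ := exists_radius hr hC₂
  refine ⟨min δ₁ δ₂, lt_min hδ₁ hδ₂, (min_le_left _ _).trans (by linarith), fun s hs => ?_⟩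
  have hsabs : |s - r| < min δ₁ δ₂ := abs_lt.2 ⟨by linarith [hs.1], by linarith [hs.2]⟩
  have hs1 : 1 < s := by linarith [hs.1, min_le_left δ₁ δ₂]
  rcases lt_trichotomy s r with hsr | rfl | hrs
  · have := hfact s hs1
    have h3 := hs₂ s (hsabs.trans_le (min_le_right _ _))
    rw [abs_of_neg (sub_neg.2 hsr), neg_sub] at h3
    exact hasMaxReg_of_lt hT hBr hs1 hsr (by positivity) (h₂ s hs1 hsr h3)
  · exact hBr
  · have h3 := hs₁ s (hsabs.trans_le (min_le_left _ _))
    rw [abs_of_pos (sub_pos.2 hrs)] at h3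
    exact hasMaxReg_of_gt hT hr hBr hrs (h₁ s hrs h3)

end Extrapolation

end ParabolicReg

theorem corollary3p5
    {D : Type*} [NormedAddCommGroup D] [NormedSpace ℂ D] [CompleteSpace D]
    {X : Type*} [NormedAddCommGroup X] [NormedSpace ℂ X] [CompleteSpace X]
    (ι : D →L[ℂ] X) (hι_inj : Function.Injective ι) (hι_dense : DenseRange ι)
    (T : ℝ) (hT : 0 < T)
    (B : ℝ → D →L[ℂ] X) (hB : ParabolicReg.IsAdmissible ι T B)
    (K : D →L[ℂ] X) (hK : ParabolicReg.HasAutonomousMaxReg ι T K)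
    (r : ℝ) (hr : 1 < r) (hBr : ParabolicReg.HasMaxReg ι T r B) :
    ∃ a b : ℝ, Ioo a b ⊆ Ioi 1 ∧ r ∈ Ioo a b ∧
      ∀ s ∈ Ioo a b, ParabolicReg.HasMaxReg ι T s B := by
  obtain ⟨δ, hδ, hδr, h⟩ := hBr.exists_Ioo hT hr
  exact ⟨r - δ, r + δ, fun s hs => mem_Ioi.2 (by linarith [hs.1]),
    ⟨by linarith, by linarith⟩, h⟩
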